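/- Let $\mathfrak g=\mathfrak{gl}(1|1,\mathbb C)\times\mathfrak{gl}(1|1,\mathbb C)$, written as double matrices $\left(\begin{smallmatrix}A&B\\C&D\end{smallmatrix}\middle|\begin{smallmatrix}E&F\\G&H\end{smallmatrix}\right)$. Let $G=(\mathrm{GL}\times\mathrm{GL})^+_{\mathbb C|\mathbb R}(1|1)$ be the cs Lie supergroup whose $T$-valued points, for a cs manifold $T$, are the $T$-valued points of $\mathrm{GL}(1|1,\mathbb C)\times\mathrm{GL}(1|1,\mathbb C)$ with underlying values in $$G_0=\{(\mathrm{diag}(z,r)\,|\,\mathrm{diag}(\bar z^{-1},s)) : z\in\mathbb C^\times,\ r,s>0\}.$$ Let $\theta$ exchange the two blocks, and let $K=\mathrm{UGL}^+_{\mathbb R}(1|1)$ be the subsupergroup of $\theta$-fixed points (with $K_0=\mathrm U(1)\times\mathbb R_{>0}$). Let $\mathfrak a=\mathbb Ch_1\oplus\mathbb Ch_2$ and $\mathfrak a_{\mathbb R}=\mathbb Rh_1\oplus\mathbb Rh_2$ with $h_1=(\mathrm{diag}(1,0)|\mathrm{diag}(-1,0))$ and $h_2=(\mathrm{diag}(0,1)|\mathrm{diag}(0,-1))$,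 and put $h^\pm=h_1\pm h_2$. The restricted roots are $\pm\alpha$, $\alpha(a_1h_1+a_2h_2)=a_1-a_2$; take $\Sigma^+=\{\alpha\}$, so that $m_\alpha=\operatorname{sdim}\mathfrak g^\alpha=-2$ and $\varrho=\tfrac12m_\alpha\alpha=-\alpha$. Let $N$ be the subsupergroup with points $\left(\begin{smallmatrix}1&B\\0&1\end{smallmatrix}\middle|\begin{smallmatrix}1&0\\G&1\end{smallmatrix}\right)$ ($B,G$ odd), let $M=Z_K(\mathfrak a)$, and let $H(g)$, a point of $\mathbb A(\mathfrak a_{\mathbb R})$, be defined by the Iwasawa decomposition $g=k(g)e^{H(g)}n(g)$ with $k(g)\in K$, $n(g)\in N$. For $\lambda\in\mathfrak a^*$ and a $K$-invariant Berezinian density $|D\dot k|$ on $K/M$, let $$\phi_\lambda(g)=\int_{K/M}|D\dot k|\;e^{(\lambda-\varrho)(H(gk))}.$$ Then there is a non-zero $K$-invariant Berezinian density $|D\dot k|$ on $K/M$ such that for all $\lambda\in\mathfrak a^*$ the following hold. 1. For every cs manifold $T$ and every $T$-valued point $h$ of $\mathbb A(\mathfrak a_{\mathbb R})$ (that is, $h=t_1h_1+t_2h_2$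 with even superfunctions $t_1,t_2$ on $T$ with real values), $$\phi_\lambda(e^h)=-\lambda(h^+)\,e^{\lambda(h)}\sinh\alpha(h).$$ 2. The identity $\phi_\lambda(e^{-h})=\phi_\lambda(e^h)$ holds for all such $T$ and $h$ if and only if $\lambda(h^+)=0$. In particular $\phi_\lambda$ is not invariant under $h\mapsto-h$ whenever $\lambda(h^+)\neq0$. 3. Let $h_0=c_+h^++c_-h^-$ with $c_\pm\in\mathbb R$, and let $c(\lambda)=\lim_{t\to\infty}e^{-(\lambda-\varrho)(th_0)}\phi_\lambda(e^{th_0})$. The limit exists if and only if $\lambda(h^+)=0$ or $c_-\ge0$. It equals $0$ if $c_-=0$, and it equals $-\tfrac12\lambda(h^+)$ if $c_->0$. 4. The function $h\mapsto\phi_\lambda(e^h)$ on $\mathfrak a_{\mathbb R}\cong\mathbb R^2$ extends to an entire function on $\mathfrak a\cong\mathbb C^2$. With $\phi_\lambda(e^{th_0})$ understood through this extension, for $h_0=c_+h^++c_-h^-$ with $c_\pm\in\mathbb C$ the limit defining $c(\lambda)$ exists if and only if $\lambda(h^+)=0$ or $c_-=0$ or $\operatorname{Re}c_->0$. It equals $0$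 if $c_-=0$, and it equals $-\tfrac12\lambda(h^+)$ if $\operatorname{Re}c_->0$. -/

import Mathlib

open scoped Manifold ContDiff Topology

namespace GL11

noncomputable section

/-! ### cs manifolds and their superfunctions -/

/-- A finite-dimensional real smooth manifold: the body of a cs manifold. -/
structure SmoothBase where
  dim : ℕ
  carrier : Type
  [top : TopologicalSpace carrier]
  [t2 : T2Space carrier]
  [sc : SecondCountableTopology carrier]
  [charted : ChartedSpace (EuclideanSpace ℝ (Fin dim)) carrier]
  [smooth : IsManifold (𝓡 dim) ∞ carrier]

attribute [instance] SmoothBase.top SmoothBase.t2 SmoothBase.sc SmoothBase.charted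
  SmoothBase.smooth

/-- Multiplication of complex numbers is smooth over `ℝ`; addition is already known to be. -/
instance : ContMDiffRing 𝓘(ℝ, ℂ) ∞ ℂ :=
  { instNormedSpaceLieAddGroup with
    contMDiff_mul := by
      rw [contMDiff_iff]
      refine ⟨continuous_mul, fun x y => ?_⟩
      simp only [mfld_simps, chartAt_self_eq]
      rw [contDiffOn_univ]
      exact contDiff_mul }

/-- The ring `C^∞(M, ℂ)` of smooth complex-valued functions. -/
abbrev SmoothBase.Fun (M : SmoothBase) : Type :=
  ContMDiffMap (𝓡 M.dim) 𝓘(ℝ, ℂ) M.carrier ℂ ∞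

/-- The one-point manifold. -/
def point : SmoothBase where
  dim := 0
  carrier := EuclideanSpace ℝ (Fin 0)

variable (M : SmoothBase) (P : Type) [AddCommGroup P] [Module M.Fun P]

/-- The algebra of global superfunctions of the cs manifold `T` with body `M` and odd coordinate
module `P`, that is `Γ(O_T) = Λ_{C^∞(M,ℂ)} P`.  For `P = C^∞(M,ℂ)^q` this is
`C^∞(M,ℂ) ⊗ Λ(ℂ^q)`; in general `P` is the module of sections of a complex vector bundle on `M`. -/
abbrev Sup : Type := ExteriorAlgebra M.Fun P

/-- The even (`i = 0`) and odd (`i = 1`) superfunctions. -/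
def parity (i : ZMod 2) : Submodule M.Fun (Sup M P) :=
  CliffordAlgebra.evenOdd (0 : QuadraticForm M.Fun P) i

variable {M P}

/-- A complex number as a constant function. -/
def constFun (M : SmoothBase) (c : ℂ) : M.Fun := ContMDiffMap.const c

/-- A complex number as a constant superfunction. -/
def const (c : ℂ) : Sup M P := algebraMap M.Fun (Sup M P) (constFun M c)

/-- The body `f₀ ∈ C^∞(M,ℂ)` of a superfunction. -/
def body (f : Sup M P) : M.Fun := ExteriorAlgebra.algebraMapInv f

/-- The value of a superfunction at a point. -/
def value (x : M.carrier) (f : Sup M P) : ℂ := body f x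

/-- The exponential `x ↦ exp (f x)` of a smooth complex-valued function. -/
def expFun (f : M.Fun) : M.Fun :=
  ⟨fun x => Complex.exp (f x),
    (Complex.contDiff_exp (𝕜 := ℝ) (n := ∞)).contMDiff.comp f.contMDiff⟩

/-- The exponential of a superfunction: with `f = f₀ + n`, `f₀` the body and `n` nilpotent, it is
`e^f = e^{f₀} ∑ₖ nᵏ / k!`. -/
def sexp (f : Sup M P) : Sup M P :=
  let n : Sup M P := f - algebraMap M.Fun (Sup M P) (body f)
  algebraMap M.Fun (Sup M P) (expFun (body f)) *
    ∑ k ∈ Finset.range (nilpotencyClass n), const ((k.factorial : ℂ)⁻¹) * n ^ k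

/-- The hyperbolic sine of a superfunction. -/
def ssinh (f : Sup M P) : Sup M P := const (1 / 2) * (sexp f - sexp (-f))

/-- Odd superfunctions have square zero. -/
theorem odd_sq {f : Sup M P} (hf : f ∈ parity M P 1) : f * f = 0 := by
  have h := CliffordAlgebra.map_mul_map_of_isOrtho_of_mem_evenOdd
    (QuadraticMap.Isometry.id (0 : QuadraticForm M.Fun P))
    (QuadraticMap.Isometry.id (0 : QuadraticForm M.Fun P))
    (fun x y => by simp [QuadraticMap.IsOrtho]) f f hf hf
  rw [CliffordAlgebra.map_id] at h
  have h2 : f * f = -(f * f) := by simpa using h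
  have h3 : f * f + f * f = 0 := by
    nth_rewrite 1 [h2]
    simp
  have h4 : constFun M (1 / 2) + constFun M (1 / 2) = 1 := by
    ext x
    change (1 / 2 : ℂ) + 1 / 2 = 1
    norm_num
  calc f * f = (constFun M (1 / 2) + constFun M (1 / 2)) • (f * f) := by rw [h4, one_smul]
    _ = constFun M (1 / 2) • (f * f + f * f) := by rw [add_smul, smul_add]
    _ = 0 := by rw [h3, smul_zero]

/-! ### The product `T × 𝔸^{0|2}` and the Berezin integral along its second factor -/

/-- The odd coordinate module of `T × 𝔸^{0|2}`. -/
abbrev Odd2 (M : SmoothBase) (P : Type) : Type := P × (Fin 2 → M.Fun)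

/-- Pullback of superfunctions along the projection `T × 𝔸^{0|2} → T`. -/
def pr : Sup M P →ₐ[M.Fun] Sup M (Odd2 M P) :=
  ExteriorAlgebra.map (LinearMap.inl M.Fun P (Fin 2 → M.Fun))

/-- The odd coordinates `ξ₀, ξ₁` of `𝔸^{0|2}`. -/
def xi (i : Fin 2) : Sup M (Odd2 M P) :=
  ExteriorAlgebra.ι M.Fun ((0, Pi.single i 1) : Odd2 M P)

/-- The odd derivation `∂/∂ξᵢ`. -/
def dXi (i : Fin 2) : Sup M (Odd2 M P) →ₗ[M.Fun] Sup M (Odd2 M P) :=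
  CliffordAlgebra.contractLeft
    ((LinearMap.proj i).comp (LinearMap.snd M.Fun P (Fin 2 → M.Fun)))

/-- The Berezin fibre integral `∫ |D(ξ₀,ξ₁)| F` along `T × 𝔸^{0|2} → T`: the coefficient of
`ξ₀ ξ₁` in `F`. -/
def berezin (F : Sup M (Odd2 M P)) : Sup M P :=
  ExteriorAlgebra.map (LinearMap.fst M.Fun P (Fin 2 → M.Fun)) (dXi 1 (dXi 0 F))

/-- The linear map underlying `subst`. -/
def substLin (b c : Sup M (Odd2 M P)) : Odd2 M P →ₗ[M.Fun] Sup M (Odd2 M P) :=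
  ((pr (M := M) (P := P)).toLinearMap.comp (ExteriorAlgebra.ι M.Fun)).comp
      (LinearMap.fst M.Fun P (Fin 2 → M.Fun)) +
    (((LinearMap.proj 0).comp (LinearMap.snd M.Fun P (Fin 2 → M.Fun))).smulRight b +
      ((LinearMap.proj 1).comp (LinearMap.snd M.Fun P (Fin 2 → M.Fun))).smulRight c)

theorem substLin_mem {b c : Sup M (Odd2 M P)} (hb : b ∈ parity M (Odd2 M P) 1)
    (hc : c ∈ parity M (Odd2 M P) 1) (v : Odd2 M P) :
    substLin b c v ∈ parity M (Odd2 M P) 1 := by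
  have h1 : substLin b c v
      = ExteriorAlgebra.ι M.Fun ((v.1, 0) : Odd2 M P) + (v.2 0 • b + v.2 1 • c) := by
    simp [substLin, pr]
  rw [h1]
  exact add_mem (CliffordAlgebra.ι_mem_evenOdd_one _ _)
    (add_mem (Submodule.smul_mem _ _ hb) (Submodule.smul_mem _ _ hc))

/-- Pullback of superfunctions along the morphism `(s, ξ) ↦ (s, (b, c))` from `T × 𝔸^{0|2}` to
itself over `T`, for odd superfunctions `b, c`: it fixes the superfunctions of `T` and sends
`ξ₀ ↦ b`, `ξ₁ ↦ c`. -/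
def subst (b c : Sup M (Odd2 M P)) (hb : b ∈ parity M (Odd2 M P) 1)
    (hc : c ∈ parity M (Odd2 M P) 1) : Sup M (Odd2 M P) →ₐ[M.Fun] Sup M (Odd2 M P) :=
  ExteriorAlgebra.lift M.Fun ⟨substLin b c, fun v => odd_sq (substLin_mem hb hc v)⟩

/-! ### Double matrices and the supergroups `G ⊇ K ⊇ M`, `A`, `N` through their points -/

/-- Double matrices `(A B; C D | E F; G H)`, with blockwise addition and multiplication. -/
abbrev DMat (A : Type) : Type := Matrix (Fin 2) (Fin 2) A × Matrix (Fin 2) (Fin 2) A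

/-- Entrywise application of a function. -/
def DMat.map {A B : Type} (f : A → B) (g : DMat A) : DMat B := (g.1.map f, g.2.map f)

/-- The involution `θ` exchanging the two blocks. -/
def theta {A : Type} (g : DMat A) : DMat A := (g.2, g.1)

variable (M P) in
/-- The `T`-valued points of `GL(1|1,ℂ) × GL(1|1,ℂ)`: invertible pairs of supermatrices with even
diagonal entries and odd off-diagonal entries. -/
def ptsGC : Set (DMat (Sup M P)) :=
  {g | IsUnit g ∧ ∀ i j : Fin 2,
    g.1 i j ∈ parity M P (if i = j then 0 else 1) ∧
    g.2 i j ∈ parity M P (if i = j then 0 else 1)}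

/-- The real form `G₀` of the body of `GL(1|1,ℂ) × GL(1|1,ℂ)`. -/
def G₀ : Set (DMat ℂ) :=
  {g | ∃ (z : ℂ) (r s : ℝ), z ≠ 0 ∧ 0 < r ∧ 0 < s ∧
    g = (!![z, 0; 0, (r : ℂ)], !![(starRingEnd ℂ z)⁻¹, 0; 0, (s : ℂ)])}

variable (M P) in
/-- The `T`-valued points of the cs form `G = (GL × GL)⁺_{ℂ|ℝ}(1|1)` defined by `G₀`: the points
of the complex supergroup whose body takes values in `G₀`. -/
def ptsG : Set (DMat (Sup M P)) :=
  {g | g ∈ ptsGC M P ∧ ∀ x : M.carrier, g.map (value x) ∈ G₀}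

variable (M P) in
/-- The `T`-valued points of `K = UGL⁺_ℝ(1|1)`, the subsupergroup of `θ`-fixed points of `G`.  Its
body consists of the `(diag(z, r), diag(z, r))` with `|z| = 1`, `r > 0`. -/
def ptsK : Set (DMat (Sup M P)) := {k | k ∈ ptsG M P ∧ theta k = k}

/-- The Cartan subspace `𝔞 = 𝔭_ev`: the even (diagonal) elements of `𝔤` with `θ x = -x`. -/
def cartan : Submodule ℂ (DMat ℂ) where
  carrier := {x | (∀ i j, i ≠ j → x.1 i j = 0 ∧ x.2 i j = 0) ∧ theta x = -x}
  zero_mem' := by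
    refine ⟨fun i j _ => ⟨rfl, rfl⟩, ?_⟩
    simp [theta]
  add_mem' := by
    rintro x y ⟨hx, hx'⟩ ⟨hy, hy'⟩
    refine ⟨fun i j h => ?_, ?_⟩
    · simp [hx i j h, hy i j h]
    · rw [neg_add, ← hx', ← hy']
      rfl
  smul_mem' := by
    rintro c x ⟨hx, hx'⟩
    refine ⟨fun i j h => ?_, ?_⟩
    · simp [hx i j h]
    · rw [← smul_neg, ← hx']
      rfl

/-- The element `h₁ = (1 0; 0 0 | -1 0; 0 0)` of `𝔞`. -/
def h₁ : cartan := ⟨(!![1, 0; 0, 0], !![-1, 0; 0, 0]), by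
  refine ⟨fun i j h => ?_, ?_⟩
  · fin_cases i <;> fin_cases j <;> simp_all
  · refine Prod.ext ?_ ?_ <;> ext i j <;> fin_cases i <;> fin_cases j <;> simp [theta]⟩

/-- The element `h₂ = (0 0; 0 1 | 0 0; 0 -1)` of `𝔞`. -/
def h₂ : cartan := ⟨(!![0, 0; 0, 1], !![0, 0; 0, -1]), by
  refine ⟨fun i j h => ?_, ?_⟩
  · fin_cases i <;> fin_cases j <;> simp_all
  · refine Prod.ext ?_ ?_ <;> ext i j <;> fin_cases i <;> fin_cases j <;> simp [theta]⟩

/-- `h⁺ = h₁ + h₂`. -/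
def hPlus : cartan := h₁ + h₂

/-- `h⁻ = h₁ - h₂`. -/
def hMinus : cartan := h₁ - h₂

variable (M P) in
/-- The `T`-valued points of the centraliser `M = Z_K(𝔞)`. -/
def ptsM : Set (DMat (Sup M P)) :=
  {m | m ∈ ptsK M P ∧ ∀ h : cartan,
    m * (h : DMat ℂ).map const = (h : DMat ℂ).map const * m}

variable (M P) in
/-- The `T`-valued points `h = t₁ h₁ + t₂ h₂` of `𝔸(𝔞_ℝ)`: pairs of even superfunctions with real
values. -/
@[ext] structure APt where
  t₁ : Sup M P
  t₂ : Sup M P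
  even₁ : t₁ ∈ parity M P 0
  even₂ : t₂ ∈ parity M P 0
  real₁ : ∀ x, (value x t₁).im = 0
  real₂ : ∀ x, (value x t₂).im = 0

instance : Zero (APt M P) :=
  ⟨⟨0, 0, zero_mem _, zero_mem _, fun x => by simp [value, body], fun x => by simp [value, body]⟩⟩

/-- The symmetry `h ↦ -h` of `𝔸(𝔞_ℝ)`. -/
instance : Neg (APt M P) :=
  ⟨fun h => ⟨-h.t₁, -h.t₂, neg_mem h.even₁, neg_mem h.even₂,
    fun x => by simpa [value, body] using h.real₁ x,
    fun x => by simpa [value, body] using h.real₂ x⟩⟩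

/-- The superfunction `λ(h) = λ(h₁) t₁ + λ(h₂) t₂`, for `λ ∈ 𝔞^*` and a point `h` of `𝔸(𝔞_ℝ)`. -/
def pairing (l : Module.Dual ℂ cartan) (h : APt M P) : Sup M P :=
  const (l h₁) * h.t₁ + const (l h₂) * h.t₂

/-- The point `e^h` of `A ⊆ G`. -/
def expA (h : APt M P) : DMat (Sup M P) :=
  (!![sexp h.t₁, 0; 0, sexp h.t₂], !![sexp (-h.t₁), 0; 0, sexp (-h.t₂)])

variable (M P) in
/-- The `T`-valued points `(1 B; 0 1 | 1 0; G 1)`, with `B` and `G` odd, of the subsupergroup `N`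
with Lie superalgebra `𝔫 = 𝔤^α`. -/
def ptsN : Set (DMat (Sup M P)) :=
  {n | ∃ B ∈ parity M P 1, ∃ G ∈ parity M P 1, n = (!![1, B; 0, 1], !![1, 0; G, 1])}

/-! ### Restricted roots -/

/-- The restricted root `α (a₁ h₁ + a₂ h₂) = a₁ - a₂`. -/
def alpha : Module.Dual ℂ cartan where
  toFun h := (h : DMat ℂ).1 0 0 - (h : DMat ℂ).1 1 1
  map_add' x y := by simp; ring
  map_smul' c x := by simp; ring

/-- The root space `𝔤^β = ⋂_{h ∈ 𝔞} ker (ad h - β(h))`. -/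
def rootSpace (β : Module.Dual ℂ cartan) : Submodule ℂ (DMat ℂ) :=
  ⨅ h : cartan, LinearMap.ker
    (LinearMap.mulLeft ℂ (h : DMat ℂ) - LinearMap.mulRight ℂ (h : DMat ℂ) - β h • LinearMap.id)

/-- The even part of `𝔤` (diagonal blocks). -/
def evenPart : Submodule ℂ (DMat ℂ) where
  carrier := {x | ∀ i j, i ≠ j → x.1 i j = 0 ∧ x.2 i j = 0}
  zero_mem' := fun i j _ => ⟨rfl, rfl⟩
  add_mem' := fun {x y} hx hy i j h => by simp [hx i j h, hy i j h]
  smul_mem' := fun c x hx i j h => by simp [hx i j h]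

/-- The odd part of `𝔤` (antidiagonal blocks). -/
def oddPart : Submodule ℂ (DMat ℂ) where
  carrier := {x | ∀ i, x.1 i i = 0 ∧ x.2 i i = 0}
  zero_mem' := fun i => ⟨rfl, rfl⟩
  add_mem' := fun {x y} hx hy i => by simp [hx i, hy i]
  smul_mem' := fun c x hx i => by simp [hx i]

/-- The multiplicity `m_β = sdim 𝔤^β = dim 𝔤^β_ev - dim 𝔤^β_odd`. -/
def mult (β : Module.Dual ℂ cartan) : ℤ :=
  (Module.finrank ℂ ↥(rootSpace β ⊓ evenPart) : ℤ) -
    (Module.finrank ℂ ↥(rootSpace β ⊓ oddPart) : ℤ)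

/-- `ϱ = ½ ∑_{β ∈ Σ⁺} m_β β` for the positive system `Σ⁺ = {α}`. -/
def rho : Module.Dual ℂ cartan := (1 / 2 : ℂ) • ((mult alpha : ℂ) • alpha)

/-! ### The Iwasawa projection -/

/-- `g = k e^h n` for some `k` in `K` and `n` in `N`. -/
def IsIwasawa (g : DMat (Sup M P)) (h : APt M P) : Prop :=
  ∃ k ∈ ptsK M P, ∃ n ∈ ptsN M P, g = k * expA h * n

open Classical in
/-- The Iwasawa projection `H : G → 𝔸(𝔞_ℝ)`, defined by `g = k(g) e^{H(g)} n(g)`. -/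
def iwasawaH (g : DMat (Sup M P)) : APt M P :=
  if hg : ∃ h : APt M P, IsIwasawa g h then hg.choose else 0

/-! ### The homogeneous superspace `K/M` and its Berezinian densities -/

/-- The section `(b, c) ↦ (1 b; c 1 | 1 b; c 1)` of `K → K/M`.  Since
`(A B; C D) = (1 BD⁻¹; CA⁻¹ 1) diag(A, D)`, it induces an isomorphism `𝔸^{0|2} ≅ K/M`; the resulting
coordinates on `K/M` are denoted by `ξ₀, ξ₁`. -/
def kappa (b c : Sup M P) : DMat (Sup M P) := (!![1, b; c, 1], !![1, b; c, 1])

/-- A Berezinian density `|D(ξ₀,ξ₁)| w` on `K/M ≅ 𝔸^{0|2}`, given by the coefficients of the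
superfunction `w = ∑ᵢⱼ wᵢⱼ ξ₀ⁱ ξ₁ʲ`, `i, j ∈ {0, 1}`. -/
abbrev Density : Type := Fin 2 → Fin 2 → ℂ

/-- The superfunction `w` on `T × K/M`. -/
def Density.coeff (w : Density) : Sup M (Odd2 M P) :=
  ∑ i : Fin 2, ∑ j : Fin 2, const (w i j) * (xi 0 ^ (i : ℕ) * xi 1 ^ (j : ℕ))

/-- The Berezin fibre integral of a superfunction `F` on `T × K/M` against the density. -/
def Density.integral (w : Density) (F : Sup M (Odd2 M P)) : Sup M P := berezin (w.coeff * F)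

/-- `K`-invariance of a Berezinian density `ω` on `K/M`: for every `T`-valued point `k` of `K` and
every superfunction `F` on `T × K/M`, `∫ ω(x) F(k x) = ∫ ω(x) F(x)`.  Here `(b, c)` are the
coordinates of `k x`, `x` being the generic point of `K/M`. -/
def Density.IsInvariant (w : Density) : Prop :=
  ∀ (M : SmoothBase) (P : Type) [AddCommGroup P] [Module M.Fun P] [Module.Finite M.Fun P]
    [Module.Projective M.Fun P], ∀ k ∈ ptsK M P,
    ∃ (b c : Sup M (Odd2 M P)) (hb : b ∈ parity M (Odd2 M P) 1)
      (hc : c ∈ parity M (Odd2 M P) 1), ∃ m ∈ ptsM M (Odd2 M P),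
      k.map pr * kappa (xi 0) (xi 1) = kappa b c * m ∧
      ∀ F : Sup M (Odd2 M P), w.integral (subst b c hb hc F) = w.integral F

/-! ### Spherical superfunctions -/

/-- The spherical superfunction `φ_λ(g) = ∫_{K/M} |D k| e^{(λ - ϱ)(H(g k))}`, on `T`-valued points
`g` of `G`, with respect to the density `w` on `K/M`. -/
def phi (w : Density) (l : Module.Dual ℂ cartan) (g : DMat (Sup M P)) : Sup M P :=
  w.integral (sexp (pairing (l - rho) (iwasawaH (g.map pr * kappa (xi 0) (xi 1)))))

/-- The ordinary point `a₁ h₁ + a₂ h₂` of `𝔞_ℝ`, for real `a₁, a₂`. -/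
def realPt (a₁ a₂ : ℝ) : APt point PUnit where
  t₁ := const a₁
  t₂ := const a₂
  even₁ := SetLike.algebraMap_mem_graded
    (CliffordAlgebra.evenOdd (0 : QuadraticForm point.Fun PUnit)) _
  even₂ := SetLike.algebraMap_mem_graded
    (CliffordAlgebra.evenOdd (0 : QuadraticForm point.Fun PUnit)) _
  real₁ := fun _ => by
    simp only [value, body, const, ExteriorAlgebra.algebraMap_leftInverse _ _]
    exact Complex.ofReal_im _
  real₂ := fun _ => by
    simp only [value, body, const, ExteriorAlgebra.algebraMap_leftInverse _ _]
    exact Complex.ofReal_im _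

/-- The complex number `φ_λ(e^h)` at the ordinary point `h = a₁ h₁ + a₂ h₂` of `𝔞_ℝ`. -/
def phiAt (w : Density) (l : Module.Dual ℂ cartan) (a₁ a₂ : ℝ) : ℂ :=
  value (M := point) (0 : EuclideanSpace ℝ (Fin 0)) (phi w l (expA (realPt a₁ a₂)))

/-- `e^{-(λ-ϱ)(t h₀)} φ_λ(e^{t h₀})` for `h₀ = c₊ h⁺ + c₋ h⁻ ∈ 𝔞_ℝ`, that is for real `c₊, c₋`.  The
value `c(λ)` of the Harish-Chandra `c`-function is the limit of this for `t → ∞`. -/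
def cQuot (w : Density) (l : Module.Dual ℂ cartan) (cp cm t : ℝ) : ℂ :=
  Complex.exp (-(l - rho) ((t : ℂ) • ((cp : ℂ) • hPlus + (cm : ℂ) • hMinus))) *
    phiAt w l (t * (cp + cm)) (t * (cp - cm))

/-- `Φ` is the entire continuation of `a₁ h₁ + a₂ h₂ ↦ φ_λ(e^{a₁ h₁ + a₂ h₂})` from
`𝔞_ℝ ≅ ℝ²` to `𝔞 ≅ ℂ²`. -/
def IsEntireContinuation (w : Density) (l : Module.Dual ℂ cartan) (Φ : ℂ × ℂ → ℂ) : Prop :=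
  Differentiable ℂ Φ ∧ ∀ a₁ a₂ : ℝ, Φ ((a₁ : ℂ), (a₂ : ℂ)) = phiAt w l a₁ a₂

/-- The same expression for arbitrary `h₀ = c₊ h⁺ + c₋ h⁻ ∈ 𝔞` (complex `c₊, c₋`), where `Φ` is the
entire continuation of `h ↦ φ_λ(e^h)`. -/
def cQuotComplex (Φ : ℂ × ℂ → ℂ) (l : Module.Dual ℂ cartan) (cp cm : ℂ) (t : ℝ) : ℂ :=
  Complex.exp (-(l - rho) ((t : ℂ) • (cp • hPlus + cm • hMinus))) *
    Φ ((t : ℂ) * (cp + cm), (t : ℂ) * (cp - cm))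

end

end GL11

open GL11 Filter

namespace GL11

noncomputable section

/-! ### Parity, body and nilpotency of superfunctions -/

section Superfunctions

variable {M : SmoothBase} {P : Type} [AddCommGroup P] [Module M.Fun P]

/-! Everything rests on an explicit Iwasawa decomposition. For odd `b`, `c`, put ε = e^{-α(h)} and σ
= ½(1 - ε²). Then e^h κ(b, c) = k e^H n, where k has diagonal 1 ∓ σbc and off-diagonal entries εb,
εc, where n has odd entries 2σb, 2σc, and where H = h + σbc·h⁺ (`isIwasawa_iwPt`). The projection is
well defined (`IsIwasawa.unique`): for g = (g₁|g₂) = k a n, the quotient g₁⁻¹g₂ = n₁⁻¹a⁻²n₂ no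
longer contains k, its entries determine n and a², and a real-valued logarithm of a² is unique.

Since (bc)² = 0 and α(h⁺) = 0, the integrand is e^{(λ+α)(h)}(1 + λ(h⁺)σξ₀ξ₁). Its ξ₀ξ₁-coefficient,
integrated against the density -1, is -λ(h⁺)e^{λ(h)}·e^{α(h)}σ, and e^{α}σ = sinh α; this is
`phi_negDensity`.

The constant density is invariant because k = (A B; C D) acts on ξ₀ and ξ₁ by fractional linear
maps, which ξᵢ² = 0 makes affine. Their linear coefficients are Ber k and (Ber k)⁻¹, so the Berezin
integral does not change (`column_factor`, `berezinian_factor`, `berezin_subst_affine`).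

The rest is calculus on the closed formula. A symmetric φ_λ with λ(h⁺) ≠ 0 would make cosh λ(h)
vanish wherever sinh α(h) ≠ 0, which is impossible. The normalised function along th₀ is -½λ(h⁺)(1 -
e^{-4c₋t}), so its limit is governed by that of e^{-4c₋t}. -/

/-- The graded sign rule holds between orthogonal subspaces of a Clifford algebra. For the zero form
all vectors are orthogonal, so the identity isometry can be taken on both sides. -/
theorem commute_of_even {i : ZMod 2} {f g : Sup M P} (hf : f ∈ parity M P 0)
    (hg : g ∈ parity M P i) : Commute f g := by
  have h := CliffordAlgebra.commute_map_mul_map_of_isOrtho_of_mem_evenOdd_zero_left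
    (QuadraticMap.Isometry.id (0 : QuadraticForm M.Fun P))
    (QuadraticMap.Isometry.id (0 : QuadraticForm M.Fun P))
    (fun x y => by simp [QuadraticMap.IsOrtho]) f g hf hg
  rwa [CliffordAlgebra.map_id] at h

theorem odd_mul_odd {f g : Sup M P} (hf : f ∈ parity M P 1) (hg : g ∈ parity M P 1) :
    f * g = -(g * f) := by
  have h := CliffordAlgebra.map_mul_map_eq_neg_of_isOrtho_of_mem_evenOdd_one
    (QuadraticMap.Isometry.id (0 : QuadraticForm M.Fun P))
    (QuadraticMap.Isometry.id (0 : QuadraticForm M.Fun P))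
    (fun x y => by simp [QuadraticMap.IsOrtho]) f g hf hg
  rw [CliffordAlgebra.map_id] at h
  simpa using h

theorem mul_mem_parity {i j : ZMod 2} {f g : Sup M P} (hf : f ∈ parity M P i)
    (hg : g ∈ parity M P j) : f * g ∈ parity M P (i + j) :=
  SetLike.mul_mem_graded (A := CliffordAlgebra.evenOdd (0 : QuadraticForm M.Fun P)) hf hg

theorem even_mul_even {f g : Sup M P} (hf : f ∈ parity M P 0) (hg : g ∈ parity M P 0) :
    f * g ∈ parity M P 0 := by
  have h := mul_mem_parity hf hg
  rwa [zero_add] at h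

theorem even_mul_odd {f g : Sup M P} (hf : f ∈ parity M P 0) (hg : g ∈ parity M P 1) :
    f * g ∈ parity M P 1 := by
  have h := mul_mem_parity hf hg
  rwa [zero_add] at h

theorem odd_mul_even {f g : Sup M P} (hf : f ∈ parity M P 1) (hg : g ∈ parity M P 0) :
    f * g ∈ parity M P 1 := by
  have h := mul_mem_parity hf hg
  rwa [add_zero] at h

theorem odd_mul_odd_mem {f g : Sup M P} (hf : f ∈ parity M P 1) (hg : g ∈ parity M P 1) :
    f * g ∈ parity M P 0 := by
  have h := mul_mem_parity hf hg
  rwa [show (1 + 1 : ZMod 2) = 0 from rfl] at h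

theorem algebraMap_mem_even (r : M.Fun) : algebraMap M.Fun (Sup M P) r ∈ parity M P 0 :=
  SetLike.algebraMap_mem_graded (CliffordAlgebra.evenOdd (0 : QuadraticForm M.Fun P)) r

theorem one_mem_even : (1 : Sup M P) ∈ parity M P 0 := by
  simpa using algebraMap_mem_even (P := P) (1 : M.Fun)

theorem const_mem_even (c : ℂ) : (const c : Sup M P) ∈ parity M P 0 :=
  algebraMap_mem_even _

theorem pow_mem_even {f : Sup M P} (hf : f ∈ parity M P 0) (k : ℕ) : f ^ k ∈ parity M P 0 := by
  induction k with
  | zero => simpa using one_mem_even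
  | succ k ih => rw [pow_succ]; exact even_mul_even ih hf

/-- Constant functions, as a ring homomorphism. -/
def constRingHom (M : SmoothBase) (P : Type) [AddCommGroup P] [Module M.Fun P] :
    ℂ →+* Sup M P :=
  (algebraMap M.Fun (Sup M P)).comp
    { toFun := constFun M
      map_one' := rfl
      map_mul' := fun _ _ => rfl
      map_zero' := rfl
      map_add' := fun _ _ => rfl }

theorem const_add (a b : ℂ) : (const (a + b) : Sup M P) = const a + const b :=
  map_add (constRingHom M P) a b

theorem const_mul (a b : ℂ) : (const (a * b) : Sup M P) = const a * const b :=
  map_mul (constRingHom M P) a b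

theorem const_neg (a : ℂ) : (const (-a) : Sup M P) = -const a :=
  map_neg (constRingHom M P) a

theorem const_sub (a b : ℂ) : (const (a - b) : Sup M P) = const a - const b :=
  map_sub (constRingHom M P) a b

theorem const_zero : (const 0 : Sup M P) = 0 := map_zero (constRingHom M P)

theorem const_one : (const 1 : Sup M P) = 1 := map_one (constRingHom M P)

theorem const_commute (c : ℂ) (f : Sup M P) : Commute (const c) f :=
  Algebra.commutes (constFun M c) f

/-- Superfunctions form a `ℚ`-algebra. -/
instance supRatAlgebra : Algebra ℚ (Sup M P) :=
  ((constRingHom M P).comp (algebraMap ℚ ℂ)).toAlgebra' fun _ f => const_commute _ f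

theorem rat_smul_eq (q : ℚ) (f : Sup M P) : q • f = const (q : ℂ) * f := by
  rw [Algebra.smul_def]; rfl

theorem body_add (f g : Sup M P) : body (f + g) = body f + body g :=
  map_add ExteriorAlgebra.algebraMapInv f g

theorem body_mul (f g : Sup M P) : body (f * g) = body f * body g :=
  map_mul ExteriorAlgebra.algebraMapInv f g

theorem body_sub (f g : Sup M P) : body (f - g) = body f - body g :=
  map_sub ExteriorAlgebra.algebraMapInv f g

theorem body_zero : body (0 : Sup M P) = 0 := map_zero ExteriorAlgebra.algebraMapInv

theorem body_one : body (1 : Sup M P) = 1 := map_one ExteriorAlgebra.algebraMapInv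

theorem body_algebraMap (r : M.Fun) : body (algebraMap M.Fun (Sup M P) r) = r :=
  ExteriorAlgebra.algebraMap_leftInverse P r

theorem body_ι (p : P) : body (ExteriorAlgebra.ι M.Fun p) = 0 := by
  simp [body, ExteriorAlgebra.algebraMapInv]

theorem body_odd {f : Sup M P} (hf : f ∈ parity M P 1) : body f = 0 := by
  refine CliffordAlgebra.odd_induction (Q := (0 : QuadraticForm M.Fun P))
    (P := fun x _ => body (M := M) (P := P) x = 0) ?_ ?_ ?_ f hf
  · exact fun v => body_ι v
  · intro x y _ _ hx hy
    rw [body_add, hx, hy, add_zero]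
  · intro p q x _ hx
    rw [body_mul, hx, mul_zero]

/-- The value at a point, as a ring homomorphism. -/
def valueHom (x : M.carrier) : Sup M P →+* ℂ where
  toFun := value x
  map_one' := by rw [value, body_one]; rfl
  map_mul' f g := by rw [value, body_mul]; rfl
  map_zero' := by rw [value, body_zero]; rfl
  map_add' f g := by rw [value, body_add]; rfl

theorem value_add (x : M.carrier) (f g : Sup M P) : value x (f + g) = value x f + value x g :=
  map_add (valueHom x) f g

theorem value_mul (x : M.carrier) (f g : Sup M P) : value x (f * g) = value x f * value x g :=
  map_mul (valueHom x) f g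

theorem value_neg (x : M.carrier) (f : Sup M P) : value x (-f) = -value x f :=
  map_neg (valueHom x) f

theorem value_sub (x : M.carrier) (f g : Sup M P) : value x (f - g) = value x f - value x g :=
  map_sub (valueHom x) f g

theorem value_zero (x : M.carrier) : value x (0 : Sup M P) = 0 := map_zero (valueHom x)

theorem value_one (x : M.carrier) : value x (1 : Sup M P) = 1 := map_one (valueHom x)

theorem value_const (x : M.carrier) (c : ℂ) : value x (const c : Sup M P) = c := by
  rw [value, const, body_algebraMap]; rfl

theorem value_odd (x : M.carrier) {f : Sup M P} (hf : f ∈ parity M P 1) : value x f = 0 := by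
  rw [value, body_odd hf]; rfl

/-- Even elements are spanned by scalars and products `p * q * x` with `x` even. Such a product has
zero body and square zero, and sums of commuting nilpotents are nilpotent. -/
theorem isNilpotent_sub_body {f : Sup M P} (hf : f ∈ parity M P 0) :
    IsNilpotent (f - algebraMap M.Fun (Sup M P) (body f)) := by
  refine CliffordAlgebra.even_induction (Q := (0 : QuadraticForm M.Fun P))
    (motive := fun x _ => IsNilpotent
      ((x : Sup M P) - algebraMap M.Fun (Sup M P) (body (M := M) (P := P) x))) ?_ ?_ ?_ f hf
  · intro r
    have h := body_algebraMap (P := P) r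
    refine ⟨1, ?_⟩
    rw [pow_one, sub_eq_zero]
    exact congrArg _ h.symm
  · intro x y hx hy h1 h2
    have e : (x + y : Sup M P) - algebraMap M.Fun (Sup M P) (body (M := M) (P := P) (x + y))
        = (x - algebraMap M.Fun (Sup M P) (body (M := M) (P := P) x))
          + (y - algebraMap M.Fun (Sup M P) (body (M := M) (P := P) y)) := by
      rw [body_add, map_add]; abel
    rw [e]
    exact Commute.isNilpotent_add (commute_of_even (i := 0)
      (sub_mem hx (algebraMap_mem_even _)) (sub_mem hy (algebraMap_mem_even _))) h1 h2
  · intro p q x hx _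
    have hp : ExteriorAlgebra.ι M.Fun p ∈ parity M P 1 := CliffordAlgebra.ι_mem_evenOdd_one _ _
    have hq : ExteriorAlgebra.ι M.Fun q ∈ parity M P 1 := CliffordAlgebra.ι_mem_evenOdd_one _ _
    have hqx : ExteriorAlgebra.ι M.Fun q * x ∈ parity M P 1 := odd_mul_even hq hx
    refine ⟨2, ?_⟩
    change (ExteriorAlgebra.ι M.Fun p * ExteriorAlgebra.ι M.Fun q * x
      - algebraMap M.Fun (Sup M P)
        (body (ExteriorAlgebra.ι M.Fun p * ExteriorAlgebra.ι M.Fun q * x))) ^ 2 = 0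
    rw [mul_assoc, body_mul, body_ι, zero_mul, map_zero, sub_zero, sq]
    have h1 : ExteriorAlgebra.ι M.Fun q * x * ExteriorAlgebra.ι M.Fun p
        = -(ExteriorAlgebra.ι M.Fun p * (ExteriorAlgebra.ι M.Fun q * x)) := odd_mul_odd hqx hp
    have h2 : ExteriorAlgebra.ι M.Fun p * (ExteriorAlgebra.ι M.Fun q * x)
        * (ExteriorAlgebra.ι M.Fun p * (ExteriorAlgebra.ι M.Fun q * x))
        = ExteriorAlgebra.ι M.Fun p * (ExteriorAlgebra.ι M.Fun q * x * ExteriorAlgebra.ι M.Fun p)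
          * (ExteriorAlgebra.ι M.Fun q * x) := by simp only [mul_assoc]
    rw [h2, h1, mul_neg, ← mul_assoc (ExteriorAlgebra.ι M.Fun p) (ExteriorAlgebra.ι M.Fun p),
      odd_sq hp, zero_mul, neg_zero, zero_mul]

/-! ### The exponential -/

theorem expFun_add (f g : M.Fun) : expFun (f + g) = expFun f * expFun g := by
  ext x
  exact Complex.exp_add (f x) (g x)

theorem expFun_zero : expFun (0 : M.Fun) = 1 := by
  ext x
  exact Complex.exp_zero

/-- Makes the functional equation and naturality of `IsNilpotent.exp` available for the
superfunction exponential. -/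
theorem sexp_eq (f : Sup M P) : sexp f = algebraMap M.Fun (Sup M P) (expFun (body f)) *
    IsNilpotent.exp (f - algebraMap M.Fun (Sup M P) (body f)) := by
  rw [sexp, IsNilpotent.exp]
  congr 1
  refine Finset.sum_congr rfl fun k _ => ?_
  rw [rat_smul_eq]
  push_cast
  rfl

theorem sexp_add {f g : Sup M P} (hf : f ∈ parity M P 0) (hg : g ∈ parity M P 0) :
    sexp (f + g) = sexp f * sexp g := by
  have e : f + g - algebraMap M.Fun (Sup M P) (body (f + g))
      = (f - algebraMap M.Fun (Sup M P) (body f)) + (g - algebraMap M.Fun (Sup M P) (body g)) := by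
    rw [body_add, map_add]; abel
  rw [sexp_eq, sexp_eq f, sexp_eq g, e, IsNilpotent.exp_add_of_commute
    (commute_of_even (i := 0) (sub_mem hf (algebraMap_mem_even _))
      (sub_mem hg (algebraMap_mem_even _)))
    (isNilpotent_sub_body hf) (isNilpotent_sub_body hg), body_add, expFun_add, map_mul,
    mul_assoc, mul_assoc, ← mul_assoc (IsNilpotent.exp _) (algebraMap _ _ _),
    ← Algebra.commutes, mul_assoc]

theorem sexp_of_body_eq_zero {f : Sup M P} (h : body f = 0) : sexp f = IsNilpotent.exp f := by
  rw [sexp_eq, h, expFun_zero, map_one, map_zero, sub_zero, one_mul]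

theorem sexp_zero : sexp (0 : Sup M P) = 1 := by
  rw [sexp_of_body_eq_zero body_zero, IsNilpotent.exp_zero]

theorem sexp_mul_sexp_neg {f : Sup M P} (hf : f ∈ parity M P 0) : sexp f * sexp (-f) = 1 := by
  rw [← sexp_add hf (neg_mem hf), add_neg_cancel, sexp_zero]

theorem sexp_neg_mul_sexp {f : Sup M P} (hf : f ∈ parity M P 0) : sexp (-f) * sexp f = 1 := by
  rw [← sexp_add (neg_mem hf) hf, neg_add_cancel, sexp_zero]

theorem sexp_of_mul_self_eq_zero {f : Sup M P} (h : body f = 0) (hf : f * f = 0) :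
    sexp f = 1 + f := by
  rw [sexp_of_body_eq_zero h, IsNilpotent.exp_eq_sum (k := 2) (by rw [sq, hf])]
  simp [Finset.sum_range_succ]

theorem sexp_mem_even {f : Sup M P} (hf : f ∈ parity M P 0) : sexp f ∈ parity M P 0 := by
  rw [sexp]
  exact even_mul_even (algebraMap_mem_even _) (sum_mem fun k _ => even_mul_even (const_mem_even _)
    (pow_mem_even (sub_mem hf (algebraMap_mem_even _)) k))

/-- If exp a = 1, the terms of degree at least 1 sum to zero, so a = a(ad) with d a polynomial in a.
Iterating, a = a(ad)ⁿ for all n, and ad is nilpotent. -/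
theorem eq_zero_of_exp_eq_one {A : Type*} [Ring A] [Algebra ℚ A] {a : A} (ha : IsNilpotent a)
    (h : IsNilpotent.exp a = 1) : a = 0 := by
  obtain ⟨k, hk⟩ := ha
  -- The bound `k + 2` leaves room to split off the terms of degree 0 and 1.
  rw [IsNilpotent.exp_eq_sum (k := k + 2) (pow_eq_zero_of_le (by omega) hk),
    Finset.sum_range_succ', Finset.sum_range_succ'] at h
  have h1 : a * -(∑ i ∈ Finset.range k, ((i + 1 + 1).factorial : ℚ)⁻¹ • a ^ (i + 1)) = a := by
    have h2 : a * (∑ i ∈ Finset.range k, ((i + 1 + 1).factorial : ℚ)⁻¹ • a ^ (i + 1))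
        = ∑ i ∈ Finset.range k, ((i + 1 + 1).factorial : ℚ)⁻¹ • a ^ (i + 1 + 1) := by
      rw [Finset.mul_sum]
      refine Finset.sum_congr rfl fun i _ => ?_
      rw [mul_smul_comm, ← pow_succ']
    rw [mul_neg, h2]
    simp only [zero_add, Nat.factorial_one, Nat.factorial_zero, Nat.cast_one, inv_one, pow_one,
      pow_zero, one_smul, add_eq_right] at h
    exact neg_eq_of_add_eq_zero_right h
  have h3 : -(∑ i ∈ Finset.range k, ((i + 1 + 1).factorial : ℚ)⁻¹ • a ^ (i + 1))
      = a * -(∑ i ∈ Finset.range k, ((i + 1 + 1).factorial : ℚ)⁻¹ • a ^ i) := by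
    rw [mul_neg, Finset.mul_sum]
    congr 1
    refine Finset.sum_congr rfl fun i _ => ?_
    rw [mul_smul_comm, ← pow_succ']
  set d := -(∑ i ∈ Finset.range k, ((i + 1 + 1).factorial : ℚ)⁻¹ • a ^ i) with hd
  have hcomm : Commute a d :=
    (Commute.sum_right _ _ _ fun i _ => ((Commute.refl a).pow_right i).smul_right _).neg_right
  rw [h3] at h1
  have h4 : ∀ n : ℕ, a * (a * d) ^ n = a := by
    intro n
    induction n with
    | zero => simp
    | succ n ih => rw [pow_succ', ← mul_assoc, h1, ih]
  rw [← h4 k, hcomm.mul_pow, hk, zero_mul, mul_zero]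

theorem body_sexp {f : Sup M P} (hf : f ∈ parity M P 0) : body (sexp f) = expFun (body f) := by
  have h0 : body (f - algebraMap M.Fun (Sup M P) (body f)) = 0 := by
    rw [body_sub, body_algebraMap, sub_self]
  obtain ⟨k, hk⟩ := isNilpotent_sub_body hf
  rw [sexp_eq, body_mul, body_algebraMap,
    IsNilpotent.exp_eq_sum (k := k + 1) (pow_eq_zero_of_le (by omega) hk), Finset.sum_range_succ',
    body_add]
  have h1 : body (∑ i ∈ Finset.range k, ((i + 1).factorial : ℚ)⁻¹ •
      (f - algebraMap M.Fun (Sup M P) (body f)) ^ (i + 1)) = 0 := by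
    refine (map_sum ExteriorAlgebra.algebraMapInv _ _).trans (Finset.sum_eq_zero fun i _ => ?_)
    change body _ = 0
    rw [rat_smul_eq, pow_succ, ← mul_assoc, body_mul, h0, mul_zero]
  rw [h1]
  simp [body_one]

theorem value_sexp (x : M.carrier) {f : Sup M P} (hf : f ∈ parity M P 0) :
    value x (sexp f) = Complex.exp (value x f) := by
  rw [value, body_sexp hf]; rfl

/-- Real values exclude the periods 2πi, so the difference has body zero; it is then nilpotent with
exponential 1. -/
theorem sexp_injective {f g : Sup M P} (hf : f ∈ parity M P 0) (hg : g ∈ parity M P 0)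
    (hf' : ∀ x, (value x f).im = 0) (hg' : ∀ x, (value x g).im = 0) (h : sexp f = sexp g) :
    f = g := by
  have he : f - g ∈ parity M P 0 := sub_mem hf hg
  have h1 : sexp (f - g) = 1 := by
    rw [sub_eq_add_neg, sexp_add hf (neg_mem hg), h, sexp_mul_sexp_neg hg]
  have h2 : body (f - g) = 0 := by
    ext x
    change value x (f - g) = 0
    have h3 : Complex.exp (value x (f - g)) = 1 := by rw [← value_sexp x he, h1, value_one]
    have h4 : value x (f - g) = ((value x (f - g)).re : ℂ) := by
      apply Complex.ext
      · rfl
      · rw [value_sub, Complex.sub_im, hf', hg', sub_zero, Complex.ofReal_im]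
    rw [h4, ← Complex.ofReal_exp] at h3
    rw [h4, (Real.exp_eq_one_iff (value x (f - g)).re).1 (by exact_mod_cast h3),
      Complex.ofReal_zero]
  have h5 := isNilpotent_sub_body he
  rw [h2, map_zero, sub_zero] at h5
  rw [sexp_of_body_eq_zero h2] at h1
  exact sub_eq_zero.1 (eq_zero_of_exp_eq_one h5 h1)

end Superfunctions

section Berezin

variable {M : SmoothBase} {P Q : Type} [AddCommGroup P] [Module M.Fun P]
  [AddCommGroup Q] [Module M.Fun Q]

/-! ### Parity-preserving homomorphisms -/

theorem map_mem_even {g : Sup M P →ₐ[M.Fun] Sup M Q}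
    (hg : ∀ p, g (ExteriorAlgebra.ι M.Fun p) ∈ parity M Q 1) {f : Sup M P}
    (hf : f ∈ parity M P 0) : g f ∈ parity M Q 0 := by
  refine CliffordAlgebra.even_induction (Q := (0 : QuadraticForm M.Fun P))
    (motive := fun x _ => g x ∈ parity M Q 0) ?_ ?_ ?_ f hf
  · intro r
    have h : g (algebraMap M.Fun (Sup M P) r) ∈ parity M Q 0 := by
      rw [AlgHom.commutes]; exact algebraMap_mem_even r
    exact h
  · intro x y _ _ hx hy
    rw [map_add]; exact add_mem hx hy
  · intro p q x _ hx
    rw [map_mul, map_mul]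
    exact even_mul_even (odd_mul_odd_mem (hg p) (hg q)) hx

theorem map_mem_odd {g : Sup M P →ₐ[M.Fun] Sup M Q}
    (hg : ∀ p, g (ExteriorAlgebra.ι M.Fun p) ∈ parity M Q 1) {f : Sup M P}
    (hf : f ∈ parity M P 1) : g f ∈ parity M Q 1 := by
  refine CliffordAlgebra.odd_induction (Q := (0 : QuadraticForm M.Fun P))
    (P := fun x _ => g x ∈ parity M Q 1) ?_ ?_ ?_ f hf
  · exact hg
  · intro x y _ _ hx hy
    rw [map_add]; exact add_mem hx hy
  · intro p q x _ hx
    rw [map_mul, map_mul]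
    exact even_mul_odd (odd_mul_odd_mem (hg p) (hg q)) hx

/-- Both sides are algebra homomorphisms to the functions on the body, and both vanish on the odd
generators. -/
theorem body_map {g : Sup M P →ₐ[M.Fun] Sup M Q}
    (hg : ∀ p, g (ExteriorAlgebra.ι M.Fun p) ∈ parity M Q 1) (f : Sup M P) :
    body (g f) = body f := by
  have h : (ExteriorAlgebra.algebraMapInv.comp g : Sup M P →ₐ[M.Fun] M.Fun)
      = ExteriorAlgebra.algebraMapInv := by
    refine ExteriorAlgebra.hom_ext (LinearMap.ext fun p => ?_)
    exact (body_odd (hg p)).trans (body_ι p).symm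
  exact DFunLike.congr_fun h f

theorem sexp_map {g : Sup M P →ₐ[M.Fun] Sup M Q}
    (hg : ∀ p, g (ExteriorAlgebra.ι M.Fun p) ∈ parity M Q 1) {f : Sup M P}
    (hf : f ∈ parity M P 0) : sexp (g f) = g (sexp f) := by
  rw [sexp_eq, sexp_eq, body_map hg, map_mul, AlgHom.commutes,
    IsNilpotent.map_exp (isNilpotent_sub_body hf) g, map_sub, AlgHom.commutes]

theorem map_const (g : Sup M P →ₐ[M.Fun] Sup M Q) (c : ℂ) : g (const c) = const c :=
  AlgHom.commutes g _

/-! ### Superfunctions on `T × 𝔸^{0|2}` -/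

theorem pr_ι (p : P) : pr (M := M) (ExteriorAlgebra.ι M.Fun p)
    = ExteriorAlgebra.ι M.Fun ((p, 0) : Odd2 M P) :=
  ExteriorAlgebra.map_apply_ι _ p

theorem pr_ι_mem (p : P) : pr (M := M) (ExteriorAlgebra.ι M.Fun p) ∈ parity M (Odd2 M P) 1 := by
  rw [pr_ι]; exact CliffordAlgebra.ι_mem_evenOdd_one _ _

theorem pr_mem_even {f : Sup M P} (hf : f ∈ parity M P 0) : pr f ∈ parity M (Odd2 M P) 0 :=
  map_mem_even pr_ι_mem hf

theorem pr_mem_odd {f : Sup M P} (hf : f ∈ parity M P 1) : pr f ∈ parity M (Odd2 M P) 1 :=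
  map_mem_odd pr_ι_mem hf

theorem value_pr (x : M.carrier) (f : Sup M P) : value x (pr f) = value x f := by
  rw [value, body_map pr_ι_mem, value]

theorem sexp_pr {f : Sup M P} (hf : f ∈ parity M P 0) : sexp (pr f) = pr (sexp f) :=
  sexp_map pr_ι_mem hf

theorem pr_const (c : ℂ) : pr (const c : Sup M P) = const c := map_const _ c

theorem xi_mem (i : Fin 2) : (xi i : Sup M (Odd2 M P)) ∈ parity M (Odd2 M P) 1 :=
  CliffordAlgebra.ι_mem_evenOdd_one _ _

theorem dXi_pr (i : Fin 2) (f : Sup M P) : dXi i (pr f) = 0 := by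
  refine CliffordAlgebra.left_induction (Q := (0 : QuadraticForm M.Fun P))
    (P := fun x => dXi i (pr (M := M) (P := P) x) = 0) ?_ ?_ ?_ f
  · intro r
    have h : dXi i (pr (algebraMap M.Fun (Sup M P) r)) = 0 := by
      rw [AlgHom.commutes]
      exact CliffordAlgebra.contractLeft_algebraMap _ _ r
    exact h
  · intro x y hx hy
    rw [map_add, map_add, hx, hy, add_zero]
  · intro x p hx
    have h : dXi i (pr (ExteriorAlgebra.ι M.Fun p * x)) = 0 := by
      rw [map_mul, pr_ι]
      refine (CliffordAlgebra.contractLeft_ι_mul _ _ _).trans ?_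
      have h1 := congrArg (ExteriorAlgebra.ι M.Fun ((p, 0) : Odd2 M P) * ·) hx
      simp only [mul_zero] at h1
      refine (congrArg₂ (· - ·) ?_ h1).trans (sub_zero 0)
      simp
    exact h

theorem dXi_xi_mul (i j : Fin 2) (F : Sup M (Odd2 M P)) :
    dXi i (xi j * F) = (if i = j then F else 0) - xi j * dXi i F := by
  refine (CliffordAlgebra.contractLeft_ι_mul _ _ _).trans ?_
  congr 1
  by_cases h : i = j
  · subst h; simp
  · simp [h]

theorem berezin_normalForm (f₀ f₁ f₂ f₃ : Sup M P) :
    berezin (pr f₀ + xi 0 * pr f₁ + xi 1 * pr f₂ + xi 0 * (xi 1 * pr f₃)) = f₃ := by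
  have h : dXi 1 (dXi 0 (pr f₀ + xi 0 * pr f₁ + xi 1 * pr f₂ + xi 0 * (xi 1 * pr f₃)))
      = pr f₃ := by
    simp [dXi_xi_mul, dXi_pr]
  rw [berezin, h, pr]
  have h2 : (ExteriorAlgebra.map (LinearMap.fst M.Fun P (Fin 2 → M.Fun))).comp
      (ExteriorAlgebra.map (LinearMap.inl M.Fun P (Fin 2 → M.Fun))) = AlgHom.id M.Fun _ := by
    rw [ExteriorAlgebra.map_comp_map, LinearMap.fst_comp_inl, ExteriorAlgebra.map_id]
  exact DFunLike.congr_fun h2 f₃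

theorem xi_one_mul_xi_zero : (xi 1 * xi 0 : Sup M (Odd2 M P)) = -(xi 0 * xi 1) :=
  odd_mul_odd (xi_mem 1) (xi_mem 0)

/-- Expansion in the odd coordinates with coefficients pulled back from T, on the right. Together
with `berezin_normalForm` it makes every Berezin integral computable. -/
theorem exists_normalForm (F : Sup M (Odd2 M P)) : ∃ f₀ f₁ f₂ f₃ : Sup M P,
    F = pr f₀ + xi 0 * pr f₁ + xi 1 * pr f₂ + xi 0 * (xi 1 * pr f₃) := by
  refine CliffordAlgebra.left_induction (Q := (0 : QuadraticForm M.Fun (Odd2 M P)))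
    (P := fun x => ∃ f₀ f₁ f₂ f₃ : Sup M P,
      x = pr f₀ + xi 0 * pr f₁ + xi 1 * pr f₂ + xi 0 * (xi 1 * pr f₃)) ?_ ?_ ?_ F
  · intro r
    refine ⟨algebraMap M.Fun (Sup M P) r, 0, 0, 0, ?_⟩
    simp only [map_zero, mul_zero, add_zero, AlgHom.commutes]
  · rintro x y ⟨f₀, f₁, f₂, f₃, rfl⟩ ⟨g₀, g₁, g₂, g₃, rfl⟩
    refine ⟨f₀ + g₀, f₁ + g₁, f₂ + g₂, f₃ + g₃, ?_⟩
    simp only [map_add, mul_add]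
    abel
  · rintro x ⟨p, v⟩ ⟨f₀, f₁, f₂, f₃, rfl⟩
    have h0 : ExteriorAlgebra.ι M.Fun ((p, v) : Odd2 M P)
        = pr (ExteriorAlgebra.ι M.Fun p) + v 0 • xi 0 + v 1 • xi 1 := by
      rw [pr_ι, xi, xi, ← map_smul, ← map_smul, ← map_add, ← map_add]
      congr 1
      refine Prod.ext ?_ ?_
      · simp
      · ext i : 1
        fin_cases i <;> simp
    have hc (i : Fin 2) : pr (ExteriorAlgebra.ι M.Fun p) * xi i
        = -(xi i * pr (M := M) (ExteriorAlgebra.ι M.Fun p)) := odd_mul_odd (pr_ι_mem p) (xi_mem i)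
    have hc' (i : Fin 2) (G : Sup M (Odd2 M P)) : pr (ExteriorAlgebra.ι M.Fun p) * (xi i * G)
        = -(xi i * (pr (M := M) (ExteriorAlgebra.ι M.Fun p) * G)) := by
      rw [← mul_assoc, hc, neg_mul, mul_assoc]
    have hs (i : Fin 2) (G : Sup M (Odd2 M P)) : xi i * (xi i * G) = 0 := by
      rw [← mul_assoc, odd_sq (xi_mem i), zero_mul]
    have hx (G : Sup M (Odd2 M P)) : xi 1 * (xi 0 * G) = -(xi 0 * (xi 1 * G)) := by
      rw [← mul_assoc, xi_one_mul_xi_zero, neg_mul, mul_assoc]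
    -- Moving an odd element of T past one ξ gives a minus sign, past two none.
    have hm : ExteriorAlgebra.ι M.Fun ((p, v) : Odd2 M P)
        * (pr f₀ + xi 0 * pr f₁ + xi 1 * pr f₂ + xi 0 * (xi 1 * pr f₃))
        = pr (ExteriorAlgebra.ι M.Fun p * f₀)
          + xi 0 * pr (v 0 • f₀ - ExteriorAlgebra.ι M.Fun p * f₁)
          + xi 1 * pr (v 1 • f₀ - ExteriorAlgebra.ι M.Fun p * f₂)
          + xi 0 * (xi 1 * pr (v 0 • f₂ - v 1 • f₁ + ExteriorAlgebra.ι M.Fun p * f₃)) := by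
      rw [h0]
      simp only [add_mul, mul_add, map_add, map_sub, map_mul, map_smul, mul_sub, hc', hs, hx,
        mul_smul_comm, smul_mul_assoc, mul_neg, smul_neg, smul_zero, mul_zero, neg_neg, neg_zero]
      abel
    exact ⟨_, _, _, _, hm⟩

theorem subst_pr (b c : Sup M (Odd2 M P)) (hb : b ∈ parity M (Odd2 M P) 1)
    (hc : c ∈ parity M (Odd2 M P) 1) (f : Sup M P) : subst b c hb hc (pr f) = pr f := by
  have h : (subst b c hb hc).comp pr = pr := by
    refine ExteriorAlgebra.hom_ext (LinearMap.ext fun p => ?_)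
    change subst b c hb hc (pr (ExteriorAlgebra.ι M.Fun p)) = pr (ExteriorAlgebra.ι M.Fun p)
    rw [pr_ι, subst, ExteriorAlgebra.lift_ι_apply]
    simp [substLin, pr_ι]
  exact DFunLike.congr_fun h f

theorem subst_xi_zero (b c : Sup M (Odd2 M P)) (hb : b ∈ parity M (Odd2 M P) 1)
    (hc : c ∈ parity M (Odd2 M P) 1) : subst b c hb hc (xi 0) = b := by
  rw [xi, subst, ExteriorAlgebra.lift_ι_apply]
  simp [substLin]

theorem subst_xi_one (b c : Sup M (Odd2 M P)) (hb : b ∈ parity M (Odd2 M P) 1)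
    (hc : c ∈ parity M (Odd2 M P) 1) : subst b c hb hc (xi 1) = c := by
  rw [xi, subst, ExteriorAlgebra.lift_ι_apply]
  simp [substLin]

/-- The Berezin integral is invariant under affine substitutions `ξ₀ ↦ β + ξ₀ p`, `ξ₁ ↦ γ + ξ₁ q`
with `p q = 1`. -/
theorem berezin_subst_affine {β γ p q : Sup M P} (hβ : β ∈ parity M P 1) (hp : p ∈ parity M P 0)
    (hpq : p * q = 1) {b c : Sup M (Odd2 M P)} (hb : b ∈ parity M (Odd2 M P) 1)
    (hc : c ∈ parity M (Odd2 M P) 1) (eb : b = pr β + xi 0 * pr p) (ec : c = pr γ + xi 1 * pr q)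
    (F : Sup M (Odd2 M P)) : berezin (subst b c hb hc F) = berezin F := by
  obtain ⟨f₀, f₁, f₂, f₃, rfl⟩ := exists_normalForm F
  have hβx (G : Sup M (Odd2 M P)) : pr β * (xi 1 * G) = -(xi 1 * (pr β * G)) := by
    rw [← mul_assoc, odd_mul_odd (pr_mem_odd hβ) (xi_mem 1), neg_mul, mul_assoc]
  have hpx (G : Sup M (Odd2 M P)) : pr p * (xi 1 * G) = xi 1 * (pr p * G) := by
    rw [← mul_assoc, (commute_of_even (pr_mem_even hp) (xi_mem 1)).eq, mul_assoc]
  -- The translations `β`, `γ` only affect the coefficients of lower order; the top coefficient is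
  -- multiplied by `p * q`.
  have e : subst b c hb hc (pr f₀ + xi 0 * pr f₁ + xi 1 * pr f₂ + xi 0 * (xi 1 * pr f₃))
      = pr (f₀ + β * f₁ + γ * f₂ + β * (γ * f₃)) + xi 0 * pr (p * f₁ + p * (γ * f₃))
        + xi 1 * pr (q * f₂ - β * (q * f₃)) + xi 0 * (xi 1 * pr (p * q * f₃)) := by
    simp only [map_add, map_mul, map_sub, subst_pr, subst_xi_zero, subst_xi_one]
    rw [eb, ec]
    simp only [add_mul, mul_add, mul_sub, mul_assoc, hβx, hpx]
    abel
  rw [e, berezin_normalForm, berezin_normalForm, hpq, one_mul]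

end Berezin

/-! ### Two-by-two matrix identities over a noncommutative ring -/

section Matrices

variable {A : Type*} [Ring A]

theorem isUnit_diag {a d : A} (ha : IsUnit a) (hd : IsUnit d) : IsUnit !![a, 0; 0, d] := by
  obtain ⟨a, rfl⟩ := ha
  obtain ⟨d, rfl⟩ := hd
  refine ⟨⟨_, !![(↑a⁻¹ : A), 0; 0, (↑d⁻¹ : A)], ?_, ?_⟩, rfl⟩ <;>
    simp [Matrix.one_fin_two]

theorem isUnit_upper (B : A) : IsUnit !![1, B; 0, 1] := by
  refine ⟨⟨_, !![1, -B; 0, 1], ?_, ?_⟩, rfl⟩ <;>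
    simp [Matrix.one_fin_two]

theorem isUnit_lower (G : A) : IsUnit !![1, 0; G, 1] := by
  refine ⟨⟨_, !![1, 0; -G, 1], ?_, ?_⟩, rfl⟩ <;>
    simp [Matrix.one_fin_two]

theorem isUnit_antidiag {b c : A} (hb : b * b = 0) (hc : c * c = 0) (hcb : c * b = -(b * c)) :
    IsUnit !![1, b; c, 1] := by
  have h1 : b * (b * c) = 0 := by rw [← mul_assoc, hb, zero_mul]
  have h2 : c * (b * c) = 0 := by rw [← mul_assoc, hcb, neg_mul, mul_assoc, hc, mul_zero, neg_zero]
  have h3 : b * c * b = 0 := by rw [mul_assoc, hcb, mul_neg, h1, neg_zero]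
  have h4 : b * c * c = 0 := by rw [mul_assoc, hc, mul_zero]
  -- Since (bc)² = 0, the Schur complements 1 - bc and 1 - cb = 1 + bc have inverses 1 + bc and 1 -
  -- bc.
  refine ⟨⟨_, !![1 + b * c, -b; -c, 1 - b * c], ?_, ?_⟩, rfl⟩ <;>
    simp [Matrix.one_fin_two, mul_add, add_mul, mul_sub, sub_mul, h1, h2, h3,
      h4, hcb]

theorem matrix_fin_two_congr {A : Type*} {a a' b b' c c' d d' : A} (ha : a = a') (hb : b = b')
    (hc : c = c') (hd : d = d') : !![a, b; c, d] = !![a', b'; c', d'] := by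
  rw [ha, hb, hc, hd]

variable {R : Type*} [CommRing R] [Algebra R A]

/-- First block of the decomposition. The even quantities enter as scalars from a commutative ring,
so that only `b` and `c` need reordering and each entry reduces to an identity in `R`. -/
theorem iwasawa_upper {x x' y σ : R} {b c : A} (hx : x * x' = 1)
    (hb : b * b = 0) (hc : c * c = 0) (hcb : c * b = -(b * c))
    (hσ : σ + σ = 1 - x' * y * (x' * y)) :
    !![1 - σ • (b * c), (x' * y) • b; (x' * y) • c, 1 + σ • (b * c)]
      * !![x • (1 + σ • (b * c)), 0; 0, y • (1 + σ • (b * c))]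
      * !![1, (σ + σ) • b; 0, 1] = !![x • (1 : A), 0; 0, y • (1 : A)] * !![1, b; c, 1] := by
  have h1 : b * (b * c) = 0 := by rw [← mul_assoc, hb, zero_mul]
  have h2 : c * (b * c) = 0 := by rw [← mul_assoc, hcb, neg_mul, mul_assoc, hc, mul_zero, neg_zero]
  simp only [Matrix.mul_fin_two, mul_assoc, mul_add, add_mul, sub_mul, mul_one, one_mul, mul_zero,
    zero_mul, add_zero, zero_add, smul_mul_assoc, mul_smul_comm, smul_smul, smul_add, hcb,
    h1, h2, smul_zero, smul_neg, mul_neg, neg_zero, sub_zero]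
  refine matrix_fin_two_congr ?_ ?_ ?_ ?_
  · module
  · match_scalars
    linear_combination x * hσ - x' * y ^ 2 * hx
  · match_scalars
    linear_combination y * hx
  · match_scalars <;> first | ring1 | linear_combination -(2 * σ * y) * hx

/-- Second block, with the same k as in `iwasawa_upper`: this is what makes k fixed by θ. The torus
factor is inverted, (1 + σbc)⁻¹ being 1 - σbc. -/
theorem iwasawa_lower {x' y y' σ : R} {b c : A} (hy : y * y' = 1)
    (hb : b * b = 0) (hc : c * c = 0) (hcb : c * b = -(b * c))
    (hσ : σ + σ = 1 - x' * y * (x' * y)) :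
    !![1 - σ • (b * c), (x' * y) • b; (x' * y) • c, 1 + σ • (b * c)]
      * !![x' • (1 - σ • (b * c)), 0; 0, y' • (1 - σ • (b * c))]
      * !![1, 0; (σ + σ) • c, 1] = !![x' • (1 : A), 0; 0, y' • (1 : A)] * !![1, b; c, 1] := by
  have h1 : b * (b * c) = 0 := by rw [← mul_assoc, hb, zero_mul]
  have h2 : c * (b * c) = 0 := by rw [← mul_assoc, hcb, neg_mul, mul_assoc, hc, mul_zero, neg_zero]
  simp only [Matrix.mul_fin_two, mul_assoc, add_mul, sub_mul, mul_sub, mul_one, one_mul,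
    mul_zero, zero_mul, add_zero, zero_add, smul_mul_assoc, mul_smul_comm, smul_smul, smul_add, hc,
    h1, h2, smul_zero, sub_zero, smul_sub]
  refine matrix_fin_two_congr ?_ ?_ ?_ ?_
  · match_scalars <;> first | ring1 | linear_combination 2 * x' * σ * hy
  · match_scalars
    linear_combination x' * hy
  · match_scalars
    linear_combination y' * hσ - x' ^ 2 * y * hy
  · module

/-- The fractional linear expression (aξ + B)(d + Cξ)⁻¹ is affine in ξ because ξ² = 0. The
denominator is multiplied out to avoid inverting it. -/
theorem column_factor {a d d' : R} {B C ξ : A} (hd : d * d' = 1) (hξ : ξ * ξ = 0)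
    (hξB : ξ * B = -(B * ξ)) (hξC : ξ * C = -(C * ξ)) :
    a • ξ + B = (d' • B + ξ * d' • (a • (1 : A) - d' • (B * C))) * (d • (1 : A) + C * ξ) := by
  have h1 : ξ * (B * C) = B * (C * ξ) := by
    rw [← mul_assoc, hξB, neg_mul, mul_assoc, hξC, mul_neg, neg_neg]
  have h2 : ξ * (C * ξ) = 0 := by rw [← mul_assoc, hξC, neg_mul, mul_assoc, hξ, mul_zero, neg_zero]
  simp only [mul_add, add_mul, mul_sub, sub_mul, mul_assoc, mul_one, smul_mul_assoc,
    mul_smul_comm, smul_smul, smul_add, smul_sub, h1, h2, smul_zero, mul_zero, sub_zero,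
    add_zero]
  match_scalars
  · linear_combination (-a) * hd
  · linear_combination (-1 : R) * hd
  · linear_combination d' * hd

/-- The Berezinian computed from one Schur complement is reciprocal to the expression formed from
the other. -/
theorem berezinian_factor {a a' d d' : R} {B C : A} (ha : a * a' = 1) (hd : d * d' = 1)
    (hCB : C * B = -(B * C)) (hC : C * C = 0) :
    d' • (a • (1 : A) - d' • (B * C)) * a' • (d • (1 : A) - a' • (C * B)) = 1 := by
  have h1 : C * (B * C) = 0 := by
    rw [← mul_assoc, hCB, neg_mul, mul_assoc, hC, mul_zero, neg_zero]
  rw [hCB]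
  simp only [mul_add, sub_mul, mul_assoc, mul_one, one_mul, smul_mul_assoc,
    mul_smul_comm, smul_smul, smul_add, smul_sub, h1, smul_zero, mul_zero, sub_zero, smul_neg,
    sub_neg_eq_add]
  match_scalars
  · linear_combination d * d' * ha + hd
  · linear_combination a' * d' * ha - a' * d' * hd

end Matrices

/-! ### Even superfunctions as central scalars, and their inverses -/

section Center

variable {M : SmoothBase} {P : Type} [AddCommGroup P] [Module M.Fun P]

theorem exists_even_add_odd (f : Sup M P) :
    ∃ g ∈ parity M P 0, ∃ h ∈ parity M P 1, f = g + h := by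
  have hc := (CliffordAlgebra.evenOdd_isCompl (0 : QuadraticForm M.Fun P)).codisjoint
  obtain ⟨g, h, hg, hh, e⟩ := Submodule.codisjoint_iff_exists_add_eq.1 hc f
  exact ⟨g, hg, h, hh, e.symm⟩

theorem eq_zero_of_even_of_odd {f : Sup M P} (h0 : f ∈ parity M P 0) (h1 : f ∈ parity M P 1) :
    f = 0 :=
  Submodule.disjoint_def.1
    (CliffordAlgebra.evenOdd_isCompl (0 : QuadraticForm M.Fun P)).disjoint f h0 h1

theorem even_mem_center {f : Sup M P} (hf : f ∈ parity M P 0) : f ∈ Subring.center (Sup M P) := by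
  rw [Subring.mem_center_iff]
  intro g
  obtain ⟨g₀, h0, g₁, h1, rfl⟩ := exists_even_add_odd g
  rw [add_mul, mul_add, (commute_of_even hf h0).eq, (commute_of_even hf h1).eq]

/-- An even superfunction, as an element of the centre. -/
def toCenter (f : Sup M P) (hf : f ∈ parity M P 0) : Subring.center (Sup M P) :=
  ⟨f, even_mem_center hf⟩

theorem toCenter_smul {f : Sup M P} (hf : f ∈ parity M P 0) (g : Sup M P) :
    toCenter f hf • g = f * g := rfl

/-- The product of `f` with the odd part of `g` is both even and odd, hence zero, and `f` can be
cancelled. -/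
theorem even_inverse {f g : Sup M P} (hf : f ∈ parity M P 0) (hfg : f * g = 1) :
    g ∈ parity M P 0 := by
  have hgf : g * f = 1 := by rw [← hfg]; exact Subring.mem_center_iff.1 (even_mem_center hf) g
  obtain ⟨g₀, h0, g₁, h1, rfl⟩ := exists_even_add_odd g
  have h2 : f * g₁ = 0 := by
    refine eq_zero_of_even_of_odd ?_ (even_mul_odd hf h1)
    have h3 : f * g₁ = 1 - f * g₀ := by rw [← hfg, mul_add]; abel
    rw [h3]
    exact sub_mem one_mem_even (even_mul_even hf h0)
  have h4 : g₁ = 0 := by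
    rw [← one_mul g₁, ← hgf, mul_assoc, h2, mul_zero]
  rw [h4, add_zero]
  exact h0

/-- The inverse of a nowhere vanishing smooth function. -/
def invFun (f : M.Fun) (hf : ∀ x, f x ≠ 0) : M.Fun :=
  ⟨fun x => (f x)⁻¹, fun x =>
    ((contDiffAt_inv ℝ (hf x)).contMDiffAt (n := ∞)).comp x f.contMDiff.contMDiffAt⟩

/-- The body is invertible as a smooth function, and adding a commuting nilpotent preserves units.
-/
theorem isUnit_of_value_ne_zero {f : Sup M P} (hf : f ∈ parity M P 0)
    (h : ∀ x, value x f ≠ 0) : IsUnit f := by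
  have h1 : IsUnit (body f) := by
    refine IsUnit.of_mul_eq_one (invFun (body f) h) ?_
    ext x
    exact mul_inv_cancel₀ (h x)
  have h2 : IsUnit (algebraMap M.Fun (Sup M P) (body f)) := h1.map _
  have h3 := (isNilpotent_sub_body hf).isUnit_add_left_of_commute h2
    (Algebra.commutes (body f) _).symm
  rwa [add_sub_cancel] at h3

theorem exists_even_inverse {f : Sup M P} (hf : f ∈ parity M P 0) (h : ∀ x, value x f ≠ 0) :
    ∃ g ∈ parity M P 0, f * g = 1 := by
  obtain ⟨u, rfl⟩ := isUnit_of_value_ne_zero hf h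
  exact ⟨_, even_inverse hf u.mul_inv, u.mul_inv⟩

end Center

/-! ### The Iwasawa decomposition -/

section Iwasawa

variable {M : SmoothBase} {P : Type} [AddCommGroup P] [Module M.Fun P]

theorem isUnit_sexp {f : Sup M P} (hf : f ∈ parity M P 0) : IsUnit (sexp f) :=
  ⟨⟨_, _, sexp_mul_sexp_neg hf, sexp_neg_mul_sexp hf⟩, rfl⟩

theorem isUnit_expA (h : APt M P) : IsUnit (expA h) :=
  Prod.isUnit_iff.2 ⟨isUnit_diag (isUnit_sexp h.even₁) (isUnit_sexp h.even₂),
    isUnit_diag (isUnit_sexp (neg_mem h.even₁)) (isUnit_sexp (neg_mem h.even₂))⟩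

theorem isUnit_of_mem_ptsN {n : DMat (Sup M P)} (hn : n ∈ ptsN M P) : IsUnit n := by
  obtain ⟨B, _, G, _, rfl⟩ := hn
  exact Prod.isUnit_iff.2 ⟨isUnit_upper B, isUnit_lower G⟩

theorem isUnit_kappa {b c : Sup M P} (hb : b ∈ parity M P 1) (hc : c ∈ parity M P 1) :
    IsUnit (kappa b c) :=
  Prod.isUnit_iff.2 ⟨isUnit_antidiag (odd_sq hb) (odd_sq hc) (odd_mul_odd hc hb),
    isUnit_antidiag (odd_sq hb) (odd_sq hc) (odd_mul_odd hc hb)⟩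

theorem eq_of_add_self_eq {f g : Sup M P} (h : f + f = g + g) : f = g := by
  have e (x : Sup M P) : x = (1 / 2 : ℚ) • (x + x) := by module
  rw [e f, h, ← e g]

theorem neg_eq_of_sexp_mul_self_eq {f g : Sup M P} (hf : f ∈ parity M P 0) (hg : g ∈ parity M P 0)
    (hf' : ∀ x, (value x f).im = 0) (hg' : ∀ x, (value x g).im = 0)
    (h : sexp (-f) * sexp (-f) = sexp (-g) * sexp (-g)) : f = g := by
  rw [← sexp_add (neg_mem hf) (neg_mem hf), ← sexp_add (neg_mem hg) (neg_mem hg)] at h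
  have h1 := sexp_injective (add_mem (neg_mem hf) (neg_mem hf)) (add_mem (neg_mem hg) (neg_mem hg))
    (fun x => by simp [value_add, value_neg, hf']) (fun x => by simp [value_add, value_neg, hg']) h
  exact neg_injective (eq_of_add_self_eq h1)

/-- The third explicit matrix is n₁⁻¹a⁻²n₂. With g₁ = k a n₁ and g₂ = k a⁻¹n₂ it equals g₁⁻¹g₂,
which is independent of k. -/
theorem iwasawa_quotient {k : Matrix (Fin 2) (Fin 2) (Sup M P)} (h : APt M P) (B G : Sup M P) :
    k * !![sexp h.t₁, 0; 0, sexp h.t₂] * !![1, B; 0, 1] *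
      !![sexp (-h.t₁) * sexp (-h.t₁) - B * (sexp (-h.t₂) * sexp (-h.t₂)) * G,
          -(B * (sexp (-h.t₂) * sexp (-h.t₂)));
        sexp (-h.t₂) * sexp (-h.t₂) * G, sexp (-h.t₂) * sexp (-h.t₂)]
      = k * !![sexp (-h.t₁), 0; 0, sexp (-h.t₂)] * !![1, 0; G, 1] := by
  have e1 (X : Sup M P) : sexp h.t₁ * (sexp (-h.t₁) * X) = X := by
    rw [← mul_assoc, sexp_mul_sexp_neg h.even₁, one_mul]
  have e2 (X : Sup M P) : sexp h.t₂ * (sexp (-h.t₂) * X) = X := by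
    rw [← mul_assoc, sexp_mul_sexp_neg h.even₂, one_mul]
  rw [mul_assoc k, mul_assoc k, mul_assoc k]
  congr 1
  rw [Matrix.mul_fin_two, Matrix.mul_fin_two, Matrix.mul_fin_two]
  refine matrix_fin_two_congr ?_ ?_ ?_ ?_ <;> simp [mul_assoc, mul_sub, e1, e2]

/-- The Iwasawa projection is unique. -/
theorem IsIwasawa.unique {g : DMat (Sup M P)} {h h' : APt M P} (H : IsIwasawa g h)
    (H' : IsIwasawa g h') : h = h' := by
  obtain ⟨k, ⟨⟨⟨hku, -⟩, -⟩, hkθ⟩, n, hn, e⟩ := H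
  obtain ⟨k', ⟨-, hkθ'⟩, n', hn', e'⟩ := H'
  have hg : IsUnit g := e ▸ (hku.mul (isUnit_expA h)).mul (isUnit_of_mem_ptsN hn)
  obtain ⟨B, hB, G, hG, rfl⟩ := hn
  obtain ⟨B', hB', G', hG', rfl⟩ := hn'
  have hk : k.2 = k.1 := congrArg Prod.fst hkθ
  have hk' : k'.2 = k'.1 := congrArg Prod.fst hkθ'
  have q := iwasawa_quotient (k := k.1) h B G
  have q' := iwasawa_quotient (k := k'.1) h' B' G'
  have a1 : g.1 = k.1 * !![sexp h.t₁, 0; 0, sexp h.t₂] * !![1, B; 0, 1] := congrArg Prod.fst e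
  have a2 : g.2 = k.1 * !![sexp (-h.t₁), 0; 0, sexp (-h.t₂)] * !![1, 0; G, 1] := by
    rw [← hk]; exact congrArg Prod.snd e
  have a1' : g.1 = k'.1 * !![sexp h'.t₁, 0; 0, sexp h'.t₂] * !![1, B'; 0, 1] :=
    congrArg Prod.fst e'
  have a2' : g.2 = k'.1 * !![sexp (-h'.t₁), 0; 0, sexp (-h'.t₂)] * !![1, 0; G', 1] := by
    rw [← hk']; exact congrArg Prod.snd e'
  rw [← a1, ← a2] at q
  rw [← a1', ← a2'] at q'
  have hX := (Prod.isUnit_iff.1 hg).1.mul_left_cancel (q.trans q'.symm)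
  have x11 := congrFun (congrFun hX 1) 1
  have x01 := congrFun (congrFun hX 0) 1
  have x10 := congrFun (congrFun hX 1) 0
  have x00 := congrFun (congrFun hX 0) 0
  simp only [Matrix.of_apply, Matrix.cons_val', Matrix.cons_val_zero, Matrix.cons_val_one,
    Matrix.cons_val_fin_one] at x11 x01 x10 x00
  have u := (isUnit_sexp (neg_mem h'.even₂)).mul (isUnit_sexp (neg_mem h'.even₂))
  -- The lower right entry e^{-2t₂} determines `t₂`; the off-diagonal entries then give `B` and `G`,
  -- and the upper left entry finally gives `t₁`.
  have h2 := neg_eq_of_sexp_mul_self_eq h.even₂ h'.even₂ h.real₂ h'.real₂ x11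
  rw [h2] at x01 x10 x00
  have hBB := u.mul_right_cancel (neg_injective x01)
  have hGG := u.mul_left_cancel x10
  rw [hBB, hGG] at x00
  have h1 := neg_eq_of_sexp_mul_self_eq h.even₁ h'.even₁ h.real₁ h'.real₁ (sub_left_injective x00)
  exact APt.ext h1 h2

theorem iwasawaH_eq {g : DMat (Sup M P)} {h : APt M P} (H : IsIwasawa g h) : iwasawaH g = h := by
  have hg : ∃ h : APt M P, IsIwasawa g h := ⟨h, H⟩
  rw [iwasawaH, dif_pos hg]
  exact hg.choose_spec.unique H

/-- The coefficient `½ (1 - e^{-2α(h)})`. -/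
def iwCoeff (h : APt M P) : Sup M P :=
  const (1 / 2) * (1 - sexp (-h.t₁) * sexp h.t₂ * (sexp (-h.t₁) * sexp h.t₂))

theorem iwCoeff_mem (h : APt M P) : iwCoeff h ∈ parity M P 0 := by
  have h1 := even_mul_even (sexp_mem_even (neg_mem h.even₁)) (sexp_mem_even h.even₂)
  exact even_mul_even (const_mem_even _) (sub_mem one_mem_even (even_mul_even h1 h1))

theorem const_half_mul_add (f : Sup M P) : const (1 / 2) * f + const (1 / 2) * f = f := by
  rw [← add_mul, ← const_add, add_halves, const_one, one_mul]

theorem body_mul_odd_odd (f : Sup M P) {b : Sup M P} (hb : b ∈ parity M P 1) (c : Sup M P) :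
    body (f * (b * c)) = 0 := by
  rw [body_mul, body_mul, body_odd hb, zero_mul, mul_zero]

theorem value_mul_odd_odd (x : M.carrier) (f : Sup M P) {b : Sup M P} (hb : b ∈ parity M P 1)
    (c : Sup M P) : value x (f * (b * c)) = 0 := by
  rw [value, body_mul_odd_odd f hb]; rfl

theorem mul_odd_odd_sq {f b c : Sup M P} (hf : f ∈ parity M P 0) (hb : b ∈ parity M P 1)
    (hc : c ∈ parity M P 1) : f * (b * c) * (f * (b * c)) = 0 := by
  have h1 : b * c * (b * c) = 0 := by
    rw [mul_assoc, ← mul_assoc c, odd_mul_odd hc hb, neg_mul, mul_assoc, odd_sq hc, mul_zero,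
      neg_zero, mul_zero]
  rw [mul_assoc, ← mul_assoc (b * c), ← (commute_of_even hf (odd_mul_odd_mem hb hc)).eq,
    mul_assoc, h1, mul_zero, mul_zero]

/-- The Iwasawa projection of `e^h κ(b, c)`. -/
def iwPt (h : APt M P) {b c : Sup M P} (hb : b ∈ parity M P 1) (hc : c ∈ parity M P 1) :
    APt M P where
  t₁ := h.t₁ + iwCoeff h * (b * c)
  t₂ := h.t₂ + iwCoeff h * (b * c)
  even₁ := add_mem h.even₁ (even_mul_even (iwCoeff_mem h) (odd_mul_odd_mem hb hc))
  even₂ := add_mem h.even₂ (even_mul_even (iwCoeff_mem h) (odd_mul_odd_mem hb hc))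
  real₁ x := by rw [value_add, value_mul_odd_odd _ _ hb, add_zero, h.real₁]
  real₂ x := by rw [value_add, value_mul_odd_odd _ _ hb, add_zero, h.real₂]

theorem sexp_add_mul_odd_odd {t f b c : Sup M P} (ht : t ∈ parity M P 0) (hf : f ∈ parity M P 0)
    (hb : b ∈ parity M P 1) (hc : c ∈ parity M P 1) :
    sexp (t + f * (b * c)) = sexp t * (1 + f * (b * c)) := by
  rw [sexp_add ht (even_mul_even hf (odd_mul_odd_mem hb hc)),
    sexp_of_mul_self_eq_zero (body_mul_odd_odd f hb c) (mul_odd_odd_sq hf hb hc)]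

theorem sexp_neg_add_mul_odd_odd {t f b c : Sup M P} (ht : t ∈ parity M P 0)
    (hf : f ∈ parity M P 0) (hb : b ∈ parity M P 1) (hc : c ∈ parity M P 1) :
    sexp (-(t + f * (b * c))) = sexp (-t) * (1 - f * (b * c)) := by
  rw [neg_add, ← neg_mul, sexp_add_mul_odd_odd (neg_mem ht) (neg_mem hf) hb hc, neg_mul,
    sub_eq_add_neg]

theorem isIwasawa_iwPt (h : APt M P) {b c : Sup M P} (hb : b ∈ parity M P 1)
    (hc : c ∈ parity M P 1) : IsIwasawa (expA h * kappa b c) (iwPt h hb hc) := by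
  set x := toCenter _ (sexp_mem_even h.even₁) with hx
  set x' := toCenter _ (sexp_mem_even (neg_mem h.even₁)) with hx'
  set y := toCenter _ (sexp_mem_even h.even₂) with hy
  set y' := toCenter _ (sexp_mem_even (neg_mem h.even₂)) with hy'
  set σ := toCenter _ (iwCoeff_mem h) with hσ
  have hxx : x * x' = 1 := Subtype.ext (sexp_mul_sexp_neg h.even₁)
  have hyy : y * y' = 1 := Subtype.ext (sexp_mul_sexp_neg h.even₂)
  have hσσ : σ + σ = 1 - x' * y * (x' * y) := Subtype.ext (const_half_mul_add _)
  have hcb := odd_mul_odd hc hb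
  have hε : (x' * y : Subring.center (Sup M P)) • b = sexp (-h.t₁) * sexp h.t₂ * b := rfl
  have hεe := even_mul_even (sexp_mem_even (neg_mem h.even₁)) (sexp_mem_even h.even₂)
  have hse := even_mul_even (iwCoeff_mem h) (odd_mul_odd_mem hb hc)
  have hσ2 := add_mem (iwCoeff_mem h) (iwCoeff_mem h)
  set k := !![1 - σ • (b * c), (x' * y) • b; (x' * y) • c, 1 + σ • (b * c)] with hk
  have hn : ((!![1, (σ + σ) • b; 0, 1], !![1, 0; (σ + σ) • c, 1]) : DMat (Sup M P)) ∈ ptsN M P :=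
    ⟨_, even_mul_odd hσ2 hb, _, even_mul_odd hσ2 hc, rfl⟩
  have e : expA h * kappa b c = ((k, k) : DMat (Sup M P)) * expA (iwPt h hb hc) *
      (!![1, (σ + σ) • b; 0, 1], !![1, 0; (σ + σ) • c, 1]) := by
    have e1 := iwasawa_upper (x := x) (x' := x') (y := y) (σ := σ) hxx (odd_sq hb) (odd_sq hc)
      hcb hσσ
    have e2 := iwasawa_lower (x' := x') (y := y) (y' := y') (σ := σ) hyy (odd_sq hb)
      (odd_sq hc) hcb hσσ
    have m1 : (expA h).1 = !![x • (1 : Sup M P), 0; 0, y • (1 : Sup M P)] := by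
      simp only [expA, hx, hy, toCenter_smul, mul_one]
    have m2 : (expA h).2 = !![x' • (1 : Sup M P), 0; 0, y' • (1 : Sup M P)] := by
      simp only [expA, hx', hy', toCenter_smul, mul_one]
    have m3 : (expA (iwPt h hb hc)).1
        = !![x • (1 + σ • (b * c)), 0; 0, y • (1 + σ • (b * c))] := by
      simp only [expA, iwPt, sexp_add_mul_odd_odd h.even₁ (iwCoeff_mem h) hb hc,
        sexp_add_mul_odd_odd h.even₂ (iwCoeff_mem h) hb hc, hx, hy, hσ, toCenter_smul]
    have m4 : (expA (iwPt h hb hc)).2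
        = !![x' • (1 - σ • (b * c)), 0; 0, y' • (1 - σ • (b * c))] := by
      simp only [expA, iwPt, sexp_neg_add_mul_odd_odd h.even₁ (iwCoeff_mem h) hb hc,
        sexp_neg_add_mul_odd_odd h.even₂ (iwCoeff_mem h) hb hc, hx', hy', hσ, toCenter_smul]
    rw [← m3, ← m1] at e1
    rw [← m4, ← m2] at e2
    exact Prod.ext e1.symm e2.symm
  -- In the factorisation `e` all other factors are invertible, so k is too.
  have hku : IsUnit ((k, k) : DMat (Sup M P)) := by
    have h1 := (isUnit_expA (iwPt h hb hc)).mul (isUnit_of_mem_ptsN hn)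
    have h2 := (isUnit_expA h).mul (isUnit_kappa hb hc)
    rw [e, mul_assoc] at h2
    exact h1.mul_right_iff.1 h2
  have hke : ∀ i j, k i j ∈ parity M P (if i = j then 0 else 1) := by
    intro i j
    fin_cases i <;> fin_cases j
    · exact sub_mem one_mem_even hse
    · exact even_mul_odd hεe hb
    · exact even_mul_odd hεe hc
    · exact add_mem one_mem_even hse
  refine ⟨(k, k), ⟨⟨⟨hku, fun i j => ⟨hke i j, hke i j⟩⟩, fun p => ?_⟩, rfl⟩, _, hn, e⟩
  -- The body of k is the identity: its off-diagonal entries are odd and σbc has body zero.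
  refine ⟨1, 1, 1, one_ne_zero, one_pos, one_pos, ?_⟩
  have hv : k.map (value p) = !![1, 0; 0, 1] := by
    ext i j
    fin_cases i <;> fin_cases j
    · change value p (1 - iwCoeff h * (b * c)) = 1
      rw [value_sub, value_one, value_mul_odd_odd _ _ hb, sub_zero]
    · exact value_odd p (even_mul_odd hεe hb)
    · exact value_odd p (even_mul_odd hεe hc)
    · change value p (1 + iwCoeff h * (b * c)) = 1
      rw [value_add, value_one, value_mul_odd_odd _ _ hb, add_zero]
  simp [DMat.map, hv]

end Iwasawa

/-! ### The invariant Berezinian density -/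

section Invariance

/-- Expresses k κ(x, y) = κ(β, γ) m with m diagonal; the hypotheses say that β and γ are the
fractional linear images of x and y. -/
theorem antidiag_factor {R : Type*} [Ring R] {a b c d x y β γ : R}
    (h₀ : a * x + b = β * (d + c * x)) (h₁ : d * y + c = γ * (a + b * y)) :
    !![a, b; c, d] * !![1, x; y, 1] = !![1, β; γ, 1] * !![a + b * y, 0; 0, d + c * x] := by
  rw [Matrix.mul_fin_two, Matrix.mul_fin_two, ← h₀, ← h₁]
  refine matrix_fin_two_congr ?_ ?_ ?_ ?_
  · rw [mul_one, one_mul, mul_zero, add_zero]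
  · rw [mul_one, mul_zero, zero_add]
  · rw [mul_one, mul_zero, add_zero, add_comm]
  · rw [mul_one, mul_zero, zero_add, one_mul, add_comm]

variable {M : SmoothBase} {P : Type} [AddCommGroup P] [Module M.Fun P]

/-- The constant density `-|D(ξ₀, ξ₁)|`. -/
def negDensity : Density := fun i j => if i = 0 ∧ j = 0 then -1 else 0

theorem negDensity_ne_zero : negDensity ≠ 0 := fun h => by
  have h1 := congrFun (congrFun h 0) 0
  simp [negDensity] at h1

theorem berezin_neg (F : Sup M (Odd2 M P)) : berezin (-F) = -berezin F := by
  simp only [berezin, map_neg]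

theorem negDensity_integral (F : Sup M (Odd2 M P)) : negDensity.integral F = -berezin F := by
  have h : (negDensity.coeff : Sup M (Odd2 M P)) = -1 := by
    simp [Density.coeff, negDensity, Fin.sum_univ_two, const_neg, const_one, const_zero]
  rw [Density.integral, h, neg_one_mul, berezin_neg]

theorem commute_cartan {a d : Sup M P} (h : cartan) :
    ((!![a, 0; 0, d], !![a, 0; 0, d]) : DMat (Sup M P)) * (h : DMat ℂ).map const
      = (h : DMat ℂ).map const * (!![a, 0; 0, d], !![a, 0; 0, d]) := by
  obtain ⟨⟨X, Y⟩, hXY, -⟩ := h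
  have key (Z : Matrix (Fin 2) (Fin 2) ℂ) (h01 : Z 0 1 = 0) (h10 : Z 1 0 = 0) :
      !![a, 0; 0, d] * Z.map (const (M := M) (P := P)) = Z.map const * !![a, 0; 0, d] := by
    rw [Matrix.eta_fin_two (Z.map (const (M := M) (P := P)))]
    simp only [Matrix.map_apply, h01, h10, const_zero, Matrix.mul_fin_two, mul_zero, zero_mul,
      add_zero, zero_add]
    rw [(const_commute (Z 0 0) a).eq, (const_commute (Z 1 1) d).eq]
  exact Prod.ext (key X (hXY 0 1 (by decide)).1 (hXY 1 0 (by decide)).1)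
    (key Y (hXY 0 1 (by decide)).2 (hXY 1 0 (by decide)).2)

theorem negDensity_isInvariant : negDensity.IsInvariant := by
  intro M P _ _ _ _ k hk
  obtain ⟨⟨⟨-, hke⟩, hkv⟩, hkθ⟩ := hk
  obtain ⟨κ, κ'⟩ := k
  obtain rfl : κ' = κ := congrArg Prod.fst hkθ
  have hA : κ' 0 0 ∈ parity M P 0 := (hke 0 0).1
  have hB : κ' 0 1 ∈ parity M P 1 := (hke 0 1).1
  have hC : κ' 1 0 ∈ parity M P 1 := (hke 1 0).1
  have hD : κ' 1 1 ∈ parity M P 0 := (hke 1 1).1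
  have hvA : ∀ x, value x (κ' 0 0) ≠ 0 := by
    intro x
    obtain ⟨z, r, s, hz, -, -, e⟩ := hkv x
    have h1 := congrFun (congrFun (congrArg Prod.fst e) 0) 0
    change value x (κ' 0 0) = z at h1
    rwa [h1]
  have hvD : ∀ x, value x (κ' 1 1) ≠ 0 := by
    intro x
    obtain ⟨z, r, s, -, hr, -, e⟩ := hkv x
    have h1 := congrFun (congrFun (congrArg Prod.fst e) 1) 1
    change value x (κ' 1 1) = r at h1
    rw [h1]
    exact_mod_cast hr.ne'
  obtain ⟨A', hA', hAA⟩ := exists_even_inverse hA hvA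
  obtain ⟨D', hD', hDD⟩ := exists_even_inverse hD hvD
  have eκ : κ' = !![κ' 0 0, κ' 0 1; κ' 1 0, κ' 1 1] := Matrix.eta_fin_two κ'
  generalize κ' 0 0 = A at *
  generalize κ' 0 1 = B at *
  generalize κ' 1 0 = C at *
  generalize κ' 1 1 = D at *
  -- This is Ber k, the linear coefficient of the transformed ξ₀; for ξ₁ the coefficient is its
  -- inverse.
  have hp : D' * (A - D' * (B * C)) ∈ parity M P 0 :=
    even_mul_even hD' (sub_mem hA (even_mul_even hD' (odd_mul_odd_mem hB hC)))
  have hpq : D' * (A - D' * (B * C)) * (A' * (D - A' * (C * B))) = 1 := by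
    have h := berezinian_factor (a := toCenter A hA) (a' := toCenter A' hA') (d := toCenter D hD)
      (d' := toCenter D' hD') (B := B) (C := C) (Subtype.ext hAA) (Subtype.ext hDD)
      (odd_mul_odd hC hB) (odd_sq hC)
    simpa only [toCenter_smul, mul_one] using h
  have hb : pr (D' * B) + xi 0 * pr (D' * (A - D' * (B * C))) ∈ parity M (Odd2 M P) 1 :=
    add_mem (pr_mem_odd (even_mul_odd hD' hB)) (odd_mul_even (xi_mem 0) (pr_mem_even hp))
  have hc : pr (A' * C) + xi 1 * pr (A' * (D - A' * (C * B))) ∈ parity M (Odd2 M P) 1 :=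
    add_mem (pr_mem_odd (even_mul_odd hA' hC)) (odd_mul_even (xi_mem 1) (pr_mem_even
      (even_mul_even hA' (sub_mem hD (even_mul_even hA' (odd_mul_odd_mem hC hB))))))
  have f0 : pr A * xi 0 + pr B = (pr (D' * B) + xi 0 * pr (D' * (A - D' * (B * C))))
      * (pr D + pr C * xi 0) := by
    have h := column_factor (a := toCenter _ (pr_mem_even hA)) (d := toCenter _ (pr_mem_even hD))
      (d' := toCenter _ (pr_mem_even hD')) (B := pr B) (C := pr C) (ξ := xi 0)
      (Subtype.ext ((map_mul pr D D').symm.trans ((congrArg pr hDD).trans (map_one pr))))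
      (odd_sq (xi_mem 0)) (odd_mul_odd (xi_mem 0) (pr_mem_odd hB))
      (odd_mul_odd (xi_mem 0) (pr_mem_odd hC))
    simpa only [toCenter_smul, mul_one, map_mul, map_sub] using h
  have f1 : pr D * xi 1 + pr C = (pr (A' * C) + xi 1 * pr (A' * (D - A' * (C * B))))
      * (pr A + pr B * xi 1) := by
    have h := column_factor (a := toCenter _ (pr_mem_even hD)) (d := toCenter _ (pr_mem_even hA))
      (d' := toCenter _ (pr_mem_even hA')) (B := pr C) (C := pr B) (ξ := xi 1)
      (Subtype.ext ((map_mul pr A A').symm.trans ((congrArg pr hAA).trans (map_one pr))))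
      (odd_sq (xi_mem 1)) (odd_mul_odd (xi_mem 1) (pr_mem_odd hC))
      (odd_mul_odd (xi_mem 1) (pr_mem_odd hB))
    simpa only [toCenter_smul, mul_one, map_mul, map_sub] using h
  have hBx := odd_mul_odd_mem (pr_mem_odd hB) (xi_mem (M := M) (P := P) 1)
  have hCx := odd_mul_odd_mem (pr_mem_odd hC) (xi_mem (M := M) (P := P) 0)
  have ha : pr A + pr B * xi 1 ∈ parity M (Odd2 M P) 0 := add_mem (pr_mem_even hA) hBx
  have hd : pr D + pr C * xi 0 ∈ parity M (Odd2 M P) 0 := add_mem (pr_mem_even hD) hCx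
  have va (x : M.carrier) : value x (pr A + pr B * xi 1) = value x A := by
    rw [value_add, value_mul, value_odd x (pr_mem_odd hB), zero_mul, add_zero, value_pr]
  have vd (x : M.carrier) : value x (pr D + pr C * xi 0) = value x D := by
    rw [value_add, value_mul, value_odd x (pr_mem_odd hC), zero_mul, add_zero, value_pr]
  have hu := isUnit_diag (isUnit_of_value_ne_zero ha fun x => by rw [va]; exact hvA x)
    (isUnit_of_value_ne_zero hd fun x => by rw [vd]; exact hvD x)
  have he : ∀ i j, (!![pr A + pr B * xi 1, 0; 0, pr D + pr C * xi 0] :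
      Matrix (Fin 2) (Fin 2) (Sup M (Odd2 M P))) i j
        ∈ parity M (Odd2 M P) (if i = j then 0 else 1) := by
    intro i j
    fin_cases i <;> fin_cases j
    · exact ha
    · exact zero_mem _
    · exact zero_mem _
    · exact hd
  refine ⟨_, _, hb, hc, (!![pr A + pr B * xi 1, 0; 0, pr D + pr C * xi 0],
    !![pr A + pr B * xi 1, 0; 0, pr D + pr C * xi 0]), ⟨⟨⟨⟨Prod.isUnit_iff.2 ⟨hu, hu⟩,
      fun i j => ⟨he i j, he i j⟩⟩, fun x => ?_⟩, rfl⟩, commute_cartan⟩, ?_, fun F => ?_⟩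
  -- The diagonal factor has the same body as k, since the entries `B` and `C` have value zero;
  -- hence it lies over `G₀` as k does.
  · have hx := hkv x
    have h1 : (!![pr A + pr B * xi 1, 0; 0, pr D + pr C * xi 0] :
        Matrix (Fin 2) (Fin 2) (Sup M (Odd2 M P))).map (value x) = κ'.map (value x) := by
      rw [eκ]
      ext i j
      fin_cases i <;> fin_cases j
      · exact va x
      · exact (value_zero x).trans (value_odd x hB).symm
      · exact (value_zero x).trans (value_odd x hC).symm
      · exact vd x
    have h2 : DMat.map (value x) ((!![pr A + pr B * xi 1, 0; 0, pr D + pr C * xi 0],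
        !![pr A + pr B * xi 1, 0; 0, pr D + pr C * xi 0]) : DMat (Sup M (Odd2 M P)))
        = DMat.map (value x) (κ', κ') := Prod.ext h1 h1
    rw [h2]
    exact hx
  · have h1 : κ'.map pr * !![1, xi 0; xi 1, 1]
        = !![1, pr (D' * B) + xi 0 * pr (D' * (A - D' * (B * C)));
            pr (A' * C) + xi 1 * pr (A' * (D - A' * (C * B))), 1]
          * (!![pr A + pr B * xi 1, 0; 0, pr D + pr C * xi 0] :
            Matrix (Fin 2) (Fin 2) (Sup M (Odd2 M P))) := by
      have h2 : κ'.map pr = !![pr A, pr B; pr C, pr D] := by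
        rw [eκ]
        ext i j
        fin_cases i <;> fin_cases j <;> rfl
      rw [h2]
      exact antidiag_factor f0 f1
    exact Prod.ext h1 h1
  · rw [negDensity_integral, negDensity_integral,
      berezin_subst_affine (even_mul_odd hD' hB) hp hpq hb hc rfl rfl]

end Invariance

/-! ### The root space of `α` and `ϱ` -/

section Roots

theorem mem_rootSpace {β : Module.Dual ℂ cartan} {x : DMat ℂ} :
    x ∈ rootSpace β ↔ ∀ h : cartan, (h : DMat ℂ) * x - x * (h : DMat ℂ) = β h • x := by
  simp [rootSpace, Submodule.mem_iInf, sub_eq_zero]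

theorem alpha_h₁ : alpha h₁ = 1 := by
  change (1 : ℂ) - 0 = 1
  norm_num

theorem alpha_h₂ : alpha h₂ = -1 := by
  change (0 : ℂ) - 1 = -1
  norm_num

/-- The odd double matrices `(0 u; 0 0 | 0 0; v 0)`. -/
def oddRootVector : ℂ × ℂ →ₗ[ℂ] DMat ℂ where
  toFun u := (!![0, u.1; 0, 0], !![0, 0; u.2, 0])
  map_add' u v := by simp
  map_smul' c u := by simp

/-- The equation for `h₁` alone forces the shape: ad `h₁` has eigenvalue 1 only on the upper right
entry of the first block and the lower left entry of the second. -/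
theorem rootSpace_alpha : rootSpace alpha = LinearMap.range oddRootVector := by
  ext x
  rw [mem_rootSpace]
  constructor
  · intro h
    have h' := h h₁
    rw [alpha_h₁, one_smul] at h'
    obtain ⟨x, y⟩ := x
    rw [Matrix.eta_fin_two x, Matrix.eta_fin_two y] at h' ⊢
    generalize x 0 0 = x00, x 0 1 = x01, x 1 0 = x10, x 1 1 = x11, y 0 0 = y00, y 0 1 = y01,
      y 1 0 = y10, y 1 1 = y11 at *
    simp only [h₁, Prod.mk_mul_mk, Matrix.mul_fin_two, Prod.mk_sub_mk, Prod.mk.injEq,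
      ← Matrix.ext_iff, Fin.forall_fin_two, Matrix.sub_apply, Matrix.of_apply, Matrix.cons_val',
      Matrix.cons_val_zero, Matrix.cons_val_one, Matrix.cons_val_fin_one] at h'
    obtain ⟨⟨⟨a1, a2⟩, a3, a4⟩, ⟨b1, b2⟩, b3, b4⟩ := h'
    ring_nf at a1 a3 a4 b1 b2 b4
    refine ⟨(x01, y10), ?_⟩
    simp only [oddRootVector, LinearMap.coe_mk, AddHom.coe_mk, Prod.mk.injEq]
    refine ⟨matrix_fin_two_congr a1 rfl ?_ a4, matrix_fin_two_congr b1 ?_ rfl b4⟩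
    · linear_combination (1 / 2 : ℂ) * a3
    · linear_combination (1 / 2 : ℂ) * b2
  · rintro ⟨⟨u, v⟩, rfl⟩ ⟨⟨X, Y⟩, hXY, hθ⟩
    obtain rfl : Y = -X := congrArg Prod.fst hθ
    have h01 : X 0 1 = 0 := (hXY 0 1 (by decide)).1
    have h10 : X 1 0 = 0 := (hXY 1 0 (by decide)).1
    have hX : X = !![X 0 0, 0; 0, X 1 1] :=
      (Matrix.eta_fin_two X).trans (matrix_fin_two_congr rfl h01 h10 rfl)
    change ((X * !![0, u; 0, 0] - !![0, u; 0, 0] * X,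
      -X * !![0, 0; v, 0] - !![0, 0; v, 0] * -X) : DMat ℂ)
      = ((X 0 0 - X 1 1) • !![0, u; 0, 0], (X 0 0 - X 1 1) • !![0, 0; v, 0])
    generalize X 0 0 = a, X 1 1 = d at *
    subst hX
    refine Prod.ext ?_ ?_ <;> ext i j <;> fin_cases i <;> fin_cases j <;> simp <;> ring

theorem mult_alpha : mult alpha = -2 := by
  have h1 : rootSpace alpha ≤ oddPart := by
    rw [rootSpace_alpha]
    rintro _ ⟨u, rfl⟩ i
    fin_cases i <;> exact ⟨rfl, rfl⟩
  have h2 : rootSpace alpha ⊓ evenPart = ⊥ := by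
    rw [eq_bot_iff]
    rintro x ⟨hx, hx'⟩
    have h3 := h1 hx
    rw [Submodule.mem_bot]
    refine Prod.ext ?_ ?_ <;> ext i j <;> by_cases hij : i = j
    · subst hij; exact (h3 i).1
    · exact (hx' i j hij).1
    · subst hij; exact (h3 i).2
    · exact (hx' i j hij).2
  have hinj : Function.Injective oddRootVector := by
    intro u v huv
    refine Prod.ext ?_ ?_
    · exact congrFun (congrFun (congrArg Prod.fst huv) 0) 1
    · exact congrFun (congrFun (congrArg Prod.snd huv) 1) 0
  rw [mult, h2, inf_eq_left.2 h1, rootSpace_alpha, LinearMap.finrank_range_of_inj hinj]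
  simp

theorem rho_eq : rho = -alpha := by
  rw [rho, mult_alpha, smul_smul]
  norm_num

/-- Holds because α(h⁺) = 0; this is why λ(h⁺) appears without a shift by ϱ. -/
theorem sub_rho_hPlus (l : Module.Dual ℂ cartan) : (l - rho) hPlus = l hPlus := by
  rw [rho_eq, sub_neg_eq_add, LinearMap.add_apply, hPlus, map_add alpha, alpha_h₁, alpha_h₂]
  ring

theorem sub_rho_hMinus (l : Module.Dual ℂ cartan) : (l - rho) hMinus = l h₁ - l h₂ + 2 := by
  rw [rho_eq, sub_neg_eq_add, LinearMap.add_apply, hMinus, map_sub, map_sub, alpha_h₁, alpha_h₂]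
  ring

end Roots

/-! ### The spherical superfunction -/

section Spherical

variable {M : SmoothBase} {P : Type} [AddCommGroup P] [Module M.Fun P]

theorem pairing_mem (l : Module.Dual ℂ cartan) (h : APt M P) : pairing l h ∈ parity M P 0 :=
  add_mem (even_mul_even (const_mem_even _) h.even₁) (even_mul_even (const_mem_even _) h.even₂)

theorem pairing_alpha (h : APt M P) : pairing alpha h = h.t₁ - h.t₂ := by
  rw [pairing, alpha_h₁, alpha_h₂, const_neg, const_one, one_mul, neg_one_mul, sub_eq_add_neg]

theorem pairing_sub_rho (l : Module.Dual ℂ cartan) (h : APt M P) :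
    pairing (l - rho) h = pairing l h + pairing alpha h := by
  rw [rho_eq, sub_neg_eq_add, pairing, pairing, pairing, LinearMap.add_apply, LinearMap.add_apply,
    const_add, const_add, add_mul, add_mul]
  abel

/-- The pullback of a point of `𝔸(𝔞_ℝ)` along `T × 𝔸^{0|2} → T`. -/
def APt.pr (h : APt M P) : APt M (Odd2 M P) where
  t₁ := GL11.pr h.t₁
  t₂ := GL11.pr h.t₂
  even₁ := pr_mem_even h.even₁
  even₂ := pr_mem_even h.even₂
  real₁ x := by rw [value_pr, h.real₁]
  real₂ x := by rw [value_pr, h.real₂]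

theorem expA_pr (h : APt M P) : (expA h).map pr = expA h.pr := by
  have e (a d : Sup M P) : !![a, 0; 0, d].map pr = !![pr a, 0; 0, pr d] := by
    ext i j
    fin_cases i <;> fin_cases j <;> simp
  simp only [DMat.map, expA, APt.pr, e, ← map_neg, sexp_pr h.even₁, sexp_pr h.even₂,
    sexp_pr (neg_mem h.even₁), sexp_pr (neg_mem h.even₂)]

theorem iwCoeff_pr (h : APt M P) : iwCoeff h.pr = pr (iwCoeff h) := by
  simp only [iwCoeff, APt.pr, ← map_neg, sexp_pr h.even₂, sexp_pr (neg_mem h.even₁), map_mul,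
    map_sub, map_one, pr_const]

/-- Both coordinates of `iwPt` are shifted by the same σξ₀ξ₁, so the shift is along h⁺. -/
theorem pairing_iwPt (l : Module.Dual ℂ cartan) (h : APt M P) :
    pairing l (iwPt h.pr (xi_mem 0) (xi_mem 1))
      = pr (pairing l h) + pr (const (l hPlus) * iwCoeff h) * (xi 0 * xi 1) := by
  simp only [pairing, iwPt, iwCoeff_pr, hPlus, map_add, map_mul, pr_const, const_add,
    mul_add, add_mul, mul_assoc]
  simp only [APt.pr]
  abel

/-- The factor e^{α(h)} coming from -ϱ = α symmetrises ½(1 - e^{-2α(h)}) into the hyperbolic sine.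
-/
theorem sexp_mul_iwCoeff (h : APt M P) :
    sexp (pairing alpha h) * iwCoeff h = ssinh (pairing alpha h) := by
  have e1 : sexp (-h.t₁) * sexp h.t₂ = sexp (-pairing alpha h) := by
    rw [← sexp_add (neg_mem h.even₁) h.even₂, pairing_alpha]
    congr 1
    abel
  rw [iwCoeff, ssinh, e1, ← mul_assoc, ← (const_commute _ _).eq, mul_assoc, mul_sub, mul_one,
    ← mul_assoc (sexp (pairing alpha h)), sexp_mul_sexp_neg (pairing_mem alpha h), one_mul]

theorem phi_negDensity (l : Module.Dual ℂ cartan) (h : APt M P) :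
    phi negDensity l (expA h) =
      -(const (l hPlus) * sexp (pairing l h) * ssinh (pairing alpha h)) := by
  have hS := pairing_mem (l - rho) h
  have hc := even_mul_even (const_mem_even (l hPlus)) (iwCoeff_mem h)
  rw [phi, expA_pr, iwasawaH_eq (isIwasawa_iwPt h.pr (xi_mem 0) (xi_mem 1)), pairing_iwPt,
    sub_rho_hPlus, sexp_add_mul_odd_odd (pr_mem_even hS) (pr_mem_even hc) (xi_mem 0) (xi_mem 1),
    sexp_pr hS, negDensity_integral]
  -- Normal form of the integrand: there are no terms linear in ξ, and the top coefficient is the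
  -- value of the integral up to the sign of the density.
  have e : pr (sexp (pairing (l - rho) h))
      * (1 + pr (const (l hPlus) * iwCoeff h) * (xi 0 * xi 1))
      = pr (sexp (pairing (l - rho) h)) + xi 0 * pr 0 + xi 1 * pr 0
        + xi 0 * (xi 1 * pr (sexp (pairing (l - rho) h) * (const (l hPlus) * iwCoeff h))) := by
    have hm := even_mul_even (sexp_mem_even hS) hc
    rw [mul_add, mul_one, ← mul_assoc, ← map_mul,
      (commute_of_even (pr_mem_even hm) (odd_mul_odd_mem (xi_mem 0) (xi_mem 1))).eq]
    simp only [map_zero, mul_zero, add_zero, mul_assoc]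
  rw [e, berezin_normalForm, pairing_sub_rho,
    sexp_add (pairing_mem l h) (pairing_mem alpha h), ← sexp_mul_iwCoeff, ← mul_assoc,
    ← (const_commute (l hPlus) _).eq]
  simp only [mul_assoc]

theorem value_ssinh (x : M.carrier) {f : Sup M P} (hf : f ∈ parity M P 0) :
    value x (ssinh f) = Complex.sinh (value x f) := by
  rw [ssinh, value_mul, value_const, value_sub, value_sexp x hf, value_sexp x (neg_mem hf),
    value_neg, Complex.sinh]
  ring

theorem value_phi (l : Module.Dual ℂ cartan) (h : APt M P) (x : M.carrier) :
    value x (phi negDensity l (expA h)) = -(l hPlus *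
      Complex.exp (l h₁ * value x h.t₁ + l h₂ * value x h.t₂) *
      Complex.sinh (value x h.t₁ - value x h.t₂)) := by
  rw [phi_negDensity, value_neg, value_mul, value_mul, value_const, value_sexp x (pairing_mem l h),
    value_ssinh x (pairing_mem alpha h), pairing_alpha, value_sub, pairing, value_add, value_mul,
    value_mul, value_const, value_const]

theorem phi_negDensity_neg (l : Module.Dual ℂ cartan) (h : APt M P) (hl : l hPlus = 0) :
    phi negDensity l (expA (-h)) = phi negDensity l (expA h) := by
  rw [phi_negDensity, phi_negDensity, hl, const_zero, zero_mul, zero_mul, zero_mul, zero_mul]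

theorem phiAt_negDensity (l : Module.Dual ℂ cartan) (a₁ a₂ : ℝ) :
    phiAt negDensity l a₁ a₂ =
      -(l hPlus * Complex.exp (l h₁ * a₁ + l h₂ * a₂) * Complex.sinh (a₁ - a₂)) := by
  have h (x : point.carrier) : value x (phi negDensity l (expA (realPt a₁ a₂))) =
      -(l hPlus * Complex.exp (l h₁ * a₁ + l h₂ * a₂) * Complex.sinh (a₁ - a₂)) := by
    rw [value_phi]
    simp only [realPt, value_const]
  exact h _

theorem hPlus_eq_zero_of_symmetric (l : Module.Dual ℂ cartan)
    (H : ∀ h : APt point PUnit, phi negDensity l (expA (-h)) = phi negDensity l (expA h)) :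
    l hPlus = 0 := by
  by_contra hl
  have key (a : ℝ) (ha : a ≠ 0) : Complex.cosh (l h₁ * a) = 0 := by
    let x : point.carrier := (0 : EuclideanSpace ℝ (Fin 0))
    have h1 := (value_phi l (-realPt a 0) x).symm.trans
      ((congrArg (value x) (H (realPt a 0))).trans (value_phi l (realPt a 0) x))
    change -(l hPlus * Complex.exp (l h₁ * value _ (-(realPt a 0).t₁)
      + l h₂ * value _ (-(realPt a 0).t₂)) * Complex.sinh (value _ (-(realPt a 0).t₁)
      - value _ (-(realPt a 0).t₂))) = _ at h1
    simp only [realPt, value_neg, value_const, Complex.ofReal_zero, neg_zero, mul_zero, add_zero,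
      sub_zero, mul_neg, Complex.sinh_neg, neg_neg] at h1
    have hs : Complex.sinh (a : ℂ) ≠ 0 := by
      rw [← Complex.ofReal_sinh]
      exact_mod_cast Real.sinh_ne_zero.2 ha
    have h2 : l hPlus * Complex.sinh a * (2 * Complex.cosh (l h₁ * a)) = 0 := by
      rw [Complex.two_cosh]
      -- At h = a·h₁ the factor sinh changes sign under h ↦ -h, so symmetry forces e^{λ(h)} +
      -- e^{-λ(h)} = 0.
      linear_combination h1
    rcases mul_eq_zero.1 h2 with h3 | h3
    · exact absurd h3 (mul_ne_zero hl hs)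
    · simpa using h3
  -- If cosh z = 0, then sinh² z = -1 and cosh 2z = -1, so a = 1 and a = 2 contradict each other.
  have h1 := key 1 one_ne_zero
  have h2 := key 2 two_ne_zero
  have h3 := Complex.cosh_two_mul (l h₁)
  have h4 := Complex.cosh_sq (l h₁)
  rw [Complex.ofReal_one, mul_one] at h1
  rw [Complex.ofReal_ofNat, mul_comm, h3, h1] at h2
  rw [h1] at h4
  have : (1 : ℂ) = 0 := by linear_combination -h4 - h2
  exact one_ne_zero this

end Spherical

/-! ### The `c`-function -/

section CFunction

/-- The entire continuation of `h ↦ φ_λ(e^h)`. -/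
def phiEntire (l : Module.Dual ℂ cartan) (a : ℂ × ℂ) : ℂ :=
  -(l hPlus * Complex.exp (l h₁ * a.1 + l h₂ * a.2) * Complex.sinh (a.1 - a.2))

theorem isEntireContinuation_phiEntire (l : Module.Dual ℂ cartan) :
    IsEntireContinuation negDensity l (phiEntire l) := by
  refine ⟨?_, fun a₁ a₂ => (phiAt_negDensity l a₁ a₂).symm⟩
  unfold phiEntire
  have h : Differentiable ℂ fun a : ℂ × ℂ => a.1 - a.2 := by fun_prop
  have h1 : Differentiable ℂ fun a : ℂ × ℂ => l h₁ * a.1 + l h₂ * a.2 := by fun_prop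
  exact ((h1.cexp.const_mul _).mul (Complex.differentiable_sinh.comp h)).neg

/-- With λ - ϱ = λ + α the exponentials leave ½(1 - e^{-2α(th₀)}), and α(h₀) = 2c₋. -/
theorem cQuotComplex_phiEntire (l : Module.Dual ℂ cartan) (cp cm : ℂ) (t : ℝ) :
    cQuotComplex (phiEntire l) l cp cm t
      = -(1 / 2) * l hPlus * (1 - Complex.exp (-(4 * cm) * t)) := by
  have e1 : (l - rho) ((t : ℂ) • (cp • hPlus + cm • hMinus))
      = t * (cp * (l h₁ + l h₂) + cm * (l h₁ - l h₂ + 2)) := by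
    rw [map_smul, map_add, map_smul, map_smul, sub_rho_hPlus, sub_rho_hMinus, hPlus, map_add]
    simp only [smul_eq_mul]
  rw [cQuotComplex, phiEntire, e1, Complex.sinh]
  set E := Complex.exp (-(t * (cp * (l h₁ + l h₂) + cm * (l h₁ - l h₂ + 2)))) with hE
  set S := Complex.exp (l h₁ * (t * (cp + cm)) + l h₂ * (t * (cp - cm))) with hS
  have e2 : E * S * Complex.exp (t * (cp + cm) - t * (cp - cm)) = 1 := by
    rw [hE, hS, ← Complex.exp_add, ← Complex.exp_add, ← Complex.exp_zero]
    congr 1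
    ring
  have e3 : E * S * Complex.exp (-(t * (cp + cm) - t * (cp - cm)))
      = Complex.exp (-(4 * cm) * t) := by
    rw [hE, hS, ← Complex.exp_add, ← Complex.exp_add]
    congr 1
    ring
  linear_combination (-(1 / 2) * l hPlus) * e2 + (1 / 2 * l hPlus) * e3

theorem cQuot_negDensity (l : Module.Dual ℂ cartan) (cp cm : ℝ) :
    cQuot negDensity l cp cm = cQuotComplex (phiEntire l) l cp cm := by
  ext t
  have h := (isEntireContinuation_phiEntire l).2 (t * (cp + cm)) (t * (cp - cm))
  rw [cQuot, cQuotComplex, ← h]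
  push_cast
  rfl

theorem tendsto_exp_neg_mul {c : ℂ} (hc : 0 < c.re) :
    Tendsto (fun t : ℝ => Complex.exp (-c * t)) atTop (𝓝 0) := by
  rw [tendsto_zero_iff_norm_tendsto_zero]
  have h : (fun t : ℝ => ‖Complex.exp (-c * t)‖) = fun t => Real.exp (-(c.re * t)) := by
    ext t
    simp [Complex.norm_exp]
  rw [h]
  exact Real.tendsto_exp_neg_atTop_nhds_zero.comp (tendsto_id.const_mul_atTop hc)

/-- A limit L would satisfy |L| ≥ 1, and shifting t by s gives L e^{-cs} = L. Thus e^{-cs} = 1 for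
all s, and the derivative at 0 yields c = 0. -/
theorem not_tendsto_exp_neg_mul {c : ℂ} (hc : c.re ≤ 0) (hc0 : c ≠ 0) (L : ℂ) :
    ¬ Tendsto (fun t : ℝ => Complex.exp (-c * t)) atTop (𝓝 L) := by
  intro h
  have hL : L ≠ 0 := by
    have h1 : 1 ≤ ‖L‖ := by
      refine ge_of_tendsto h.norm ?_
      filter_upwards [eventually_ge_atTop 0] with t ht
      rw [Complex.norm_exp]
      refine Real.one_le_exp ?_
      simp only [Complex.mul_re, Complex.neg_re, Complex.ofReal_re, Complex.ofReal_im, mul_zero,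
        sub_zero]
      exact mul_nonneg (neg_nonneg.2 hc) ht
    exact norm_pos_iff.1 (one_pos.trans_le h1)
  have h1 (s : ℝ) : Complex.exp (-c * s) = 1 := by
    have h2 := h.comp (tendsto_atTop_add_const_right atTop s tendsto_id)
    have h3 : Tendsto (fun t : ℝ => Complex.exp (-c * t) * Complex.exp (-c * s)) atTop (𝓝 L) := by
      refine h2.congr fun t => ?_
      simp only [Function.comp_apply, id_eq, Complex.ofReal_add, mul_add, Complex.exp_add]
    have h4 := tendsto_nhds_unique h3 (h.mul_const (Complex.exp (-c * s)))
    exact (mul_right_eq_self₀.1 h4.symm).resolve_right hL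
  have h2 : HasDerivAt (fun s : ℝ => Complex.exp (-c * s))
      (Complex.exp (-c * (0 : ℝ)) * (-c * 1)) 0 :=
    ((Complex.ofRealCLM.hasDerivAt (x := (0 : ℝ))).const_mul (-c)).cexp
  have h3 : HasDerivAt (fun s : ℝ => Complex.exp (-c * s)) 0 0 := by
    simp only [h1]
    exact hasDerivAt_const _ _
  have h4 := h2.unique h3
  simp at h4
  exact hc0 h4

theorem tendsto_cQuotComplex (l : Module.Dual ℂ cartan) (cp : ℂ) {cm : ℂ} (hcm : 0 < cm.re) :
    Tendsto (cQuotComplex (phiEntire l) l cp cm) atTop (𝓝 (-(1 / 2) * l hPlus)) := by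
  have h : 0 < (4 * cm).re := by simpa using hcm
  have h1 := ((tendsto_exp_neg_mul h).const_sub 1).const_mul (-(1 / 2) * l hPlus)
  rw [sub_zero, mul_one] at h1
  exact h1.congr fun t => (cQuotComplex_phiEntire l cp cm t).symm

theorem tendsto_cQuotComplex_zero (l : Module.Dual ℂ cartan) (cp : ℂ) {cm : ℂ}
    (h : l hPlus = 0 ∨ cm = 0) : Tendsto (cQuotComplex (phiEntire l) l cp cm) atTop (𝓝 0) := by
  refine tendsto_const_nhds.congr fun t => ?_
  rw [cQuotComplex_phiEntire]
  rcases h with h | h <;> simp [h]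

theorem exists_tendsto_cQuotComplex_iff (l : Module.Dual ℂ cartan) (cp cm : ℂ) :
    (∃ c : ℂ, Tendsto (cQuotComplex (phiEntire l) l cp cm) atTop (𝓝 c)) ↔
      (l hPlus = 0 ∨ cm = 0 ∨ 0 < cm.re) := by
  constructor
  · rintro ⟨c, hc⟩
    by_contra! hn
    obtain ⟨hl, hcm, hre⟩ := hn
    have h4 : (4 * cm).re ≤ 0 := by
      have h : (4 * cm).re = 4 * cm.re := by simp
      linarith
    have h5 : 4 * cm ≠ 0 := mul_ne_zero (by norm_num) hcm
    -- The closed form solved for e^{-4c₋t}, which would then converge as well.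
    refine not_tendsto_exp_neg_mul h4 h5 (1 + 2 / l hPlus * c) ?_
    refine ((hc.const_mul (2 / l hPlus)).const_add 1).congr fun t => ?_
    rw [cQuotComplex_phiEntire]
    field_simp
    ring
  · rintro (h | h | h)
    · exact ⟨0, tendsto_cQuotComplex_zero l cp (Or.inl h)⟩
    · exact ⟨0, tendsto_cQuotComplex_zero l cp (Or.inr h)⟩
    · exact ⟨_, tendsto_cQuotComplex l cp h⟩

end CFunction

end

end GL11

/-! ### Assembly of the results -/

theorem mainTheorem5 :
    ∃ w : Density, w ≠ 0 ∧ w.IsInvariant ∧ ∀ l : Module.Dual ℂ cartan,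
      -- the closed formula, for all `T`-valued points `h` of `𝔸(𝔞_ℝ)`
      (∀ (M : SmoothBase) (P : Type) [AddCommGroup P] [Module M.Fun P] [Module.Finite M.Fun P]
        [Module.Projective M.Fun P] (h : APt M P),
        phi w l (expA h) =
          -(const (l hPlus) * sexp (pairing l h) * ssinh (pairing alpha h))) ∧
      -- failure of the symmetry `h ↦ -h`
      ((∀ (M : SmoothBase) (P : Type) [AddCommGroup P] [Module M.Fun P] [Module.Finite M.Fun P]
        [Module.Projective M.Fun P] (h : APt M P),
        phi w l (expA (-h)) = phi w l (expA h)) ↔ l hPlus = 0) ∧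
      -- the `c`-function along `h₀ = c₊ h⁺ + c₋ h⁻` in `𝔞_ℝ`
      (∀ cp cm : ℝ,
        ((∃ c : ℂ, Tendsto (cQuot w l cp cm) atTop (𝓝 c)) ↔ (l hPlus = 0 ∨ 0 ≤ cm)) ∧
        (cm = 0 → Tendsto (cQuot w l cp cm) atTop (𝓝 0)) ∧
        (0 < cm → Tendsto (cQuot w l cp cm) atTop (𝓝 (-(1 / 2) * l hPlus)))) ∧
      -- the `c`-function along `h₀ = c₊ h⁺ + c₋ h⁻` in `𝔞`
      ∃ Φ : ℂ × ℂ → ℂ, IsEntireContinuation w l Φ ∧ ∀ cp cm : ℂ,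
        ((∃ c : ℂ, Tendsto (cQuotComplex Φ l cp cm) atTop (𝓝 c)) ↔
          (l hPlus = 0 ∨ cm = 0 ∨ 0 < cm.re)) ∧
        (cm = 0 → Tendsto (cQuotComplex Φ l cp cm) atTop (𝓝 0)) ∧
        (0 < cm.re → Tendsto (cQuotComplex Φ l cp cm) atTop (𝓝 (-(1 / 2) * l hPlus))) := by
  refine ⟨negDensity, negDensity_ne_zero, negDensity_isInvariant, fun l => ⟨?_, ⟨?_, ?_⟩, ?_, ?_⟩⟩
  · intro M P _ _ _ _ h
    exact phi_negDensity l h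
  · intro H
    -- Ordinary points, that is T a single point without odd coordinates, already detect the failure
    -- of symmetry.
    exact hPlus_eq_zero_of_symmetric l fun h => H point PUnit h
  · intro hl M P _ _ _ _ h
    exact phi_negDensity_neg l h hl
  · intro cp cm
    rw [cQuot_negDensity]
    refine ⟨?_, fun h => tendsto_cQuotComplex_zero l cp (Or.inr (by exact_mod_cast h)),
      fun h => tendsto_cQuotComplex l cp (by simpa using h)⟩
    rw [exists_tendsto_cQuotComplex_iff, Complex.ofReal_eq_zero, Complex.ofReal_re,
      le_iff_eq_or_lt, eq_comm (a := cm)]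
  · exact ⟨phiEntire l, isEntireContinuation_phiEntire l, fun cp cm =>
      ⟨exists_tendsto_cQuotComplex_iff l cp cm, fun h => tendsto_cQuotComplex_zero l cp (Or.inr h),
        fun h => tendsto_cQuotComplex l cp h⟩⟩
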